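/- Let $V=V_0\oplus V_1$ be a finite-dimensional real supervector space of dimension $(m,n)$ with $n$ even, equipped with a symplectic form $B$ (that is, $V_0\perp V_1$, $B|_{V_0}$ is alternating and non-degenerate, so that $m$ is even, and $B|_{V_1}$ is symmetric and non-degenerate, of any signature) and with an orientation of $V_1$. Let $(e_1,\dots,e_m)$ be a symplectic basis of $V_0$ and $(f_1,\dots,f_n)$ an oriented orthonormal basis of $V_1\otimes\mathbb C$ with each $f_j\in V_1\cup iV_1$; let $(x,\xi)$ be the dual coordinates, and let $\int_V d_V(v)\,\phi(v)=(2\pi)^{-m/2}\int_{\mathbb R^m}|dx|\,\big(\tfrac{\partial}{\partial\xi^1}\cdots\tfrac{\partial}{\partial\xi^n}\phi\big)\big|_{\xi=0}$ be the Liouville integral. Let $\mathfrak{spo}(V)$ be the Lie superalgebra of endomorphisms of $V$ leaving $B$ invariant, so $\mathfrak{spo}(V)_0=\mathfrak{sp}(V_0)\oplus\mathfrak{so}(V_1)$. The superPfaffian $$\operatorname{Spf}(X)=i^{\frac{m-n}{2}}\int_V d_V(v)\,\exp\!\big(-\tfrac i2 B(v,Xv)\big)$$ is the generalized function on the supermanifold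 $\mathfrak{spo}(V)$, i.e. the generalized function on $\mathfrak{spo}(V)_0$ with values in $\Lambda(\mathfrak{spo}(V)_1^*)\otimes\mathbb C$, whose value on a smooth compactly supported density $t$ on $\mathfrak{spo}(V)_0$ is $$i^{\frac{m-n}{2}}\int_V d_V(v)\int_{\mathfrak{spo}(V)_0} t(X)\,\exp\!\big(-\tfrac i2 B(v,(X+\Xi)v)\big),$$ where $\Xi\in \mathfrak{spo}(V)_1\otimes\mathfrak{spo}(V)_1^*$ is the generic point of $\mathfrak{spo}(V)_1$, the integral over $\mathfrak{spo}(V)_0$ is computed first, and the resulting integral over $V$ converges absolutely. Its singular support is the union of the singular supports of its scalar components, i.e. the complement of the largest open subset of $\mathfrak{spo}(V)_0$ on which $\operatorname{Spf}$ is a smooth function. Let $\mathcal U\subset\mathfrak{sp}(V_0)$ be the set of $A$ for which the quadratic form $v\mapsto B(v,Av)$ on $V_0$ is non-degenerate, and let $\mathcal V=\mathcal U\times\mathfrak{so}(V_1)$. Then $\operatorname{Spf}$ is a well-defined generalized function and $$\operatorname{singsupp}(\operatorname{Spf})=\mathfrak{spo}(V)_0\setminus\mathcal V .$$ Equivalently,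 $X=(A,D)\in\mathfrak{sp}(V_0)\oplus\mathfrak{so}(V_1)$ belongs to $\operatorname{singsupp}(\operatorname{Spf})$ if and only if $A$ is not invertible. -/

import Mathlib

open MeasureTheory TopologicalSpace
open scoped ContDiff Distributions

noncomputable section

namespace SuperPfaffian

/-- The endomorphisms of `E` leaving the bilinear form `B` invariant:
`B (X v) w + B v (X w) = 0`.  This is `sp(E)` if `B` is symplectic, and `so(E)` if `B` is symmetric
and non degenerate. -/
def skewEnd {E : Type*} [NormedAddCommGroup E] [NormedSpace ℝ E] (B : LinearMap.BilinForm ℝ E) :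
    Submodule ℝ (E →L[ℝ] E) where
  carrier := {X | ∀ v w, B (X v) w + B v (X w) = 0}
  zero_mem' := by simp
  add_mem' := by
    intro X Y hX hY v w
    have h1 := hX v w
    have h2 := hY v w
    simp only [_root_.add_apply, map_add, LinearMap.add_apply]
    linarith
  smul_mem' := by
    intro c X hX v w
    have h1 := hX v w
    simp only [_root_.smul_apply, map_smul, LinearMap.smul_apply, smul_eq_mul]
    linear_combination c * h1

section Defs

variable {V₀ V₁ : Type*} [NormedAddCommGroup V₀] [NormedSpace ℝ V₀]
  [NormedAddCommGroup V₁] [NormedSpace ℝ V₁]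
  (B₀ : LinearMap.BilinForm ℝ V₀) (B₁ : LinearMap.BilinForm ℝ V₁)

/-- `B = B₀ ⊕ B₁` is a symplectic form on the supervector space `V = V₀ ⊕ V₁`: an even, non
degenerate, (super) skew symmetric bilinear form. -/
structure IsSymplectic : Prop where
  even_alt : B₀.IsAlt
  even_nondegenerate : B₀.Nondegenerate
  odd_symm : B₁.IsSymm
  odd_nondegenerate : B₁.Nondegenerate

/-- A symplectic basis of `V = V₀ ⊕ V₁`, with `dim V = (2r, n)`.
On `V₀` it consists of pairs `even (inl k), even (inr k)`, with `B₀ (even (inl k)) (even (inr k)) = 1`.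
On `V₁ ⊗ ℂ` it is the orthonormal basis `f j = coeff j • odd j`, where `odd` is a basis of `V₁` and
`coeff j ∈ {1, i}`, so that `f j ∈ V₁ ∪ i V₁`.
The orientation of `V₁` is the one for which this basis is oriented. -/
structure OrientedSymplecticBasis (r n : ℕ) where
  even : Module.Basis (Fin r ⊕ Fin r) ℝ V₀
  odd : Module.Basis (Fin n) ℝ V₁
  coeff : Fin n → ℂ
  even_inl_inl : ∀ k l, B₀ (even (.inl k)) (even (.inl l)) = 0
  even_inr_inr : ∀ k l, B₀ (even (.inr k)) (even (.inr l)) = 0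
  even_inl_inr : ∀ k l, B₀ (even (.inl k)) (even (.inr l)) = if k = l then 1 else 0
  even_inr_inl : ∀ k l, B₀ (even (.inr k)) (even (.inl l)) = if k = l then -1 else 0
  coeff_eq : ∀ j, coeff j = 1 ∨ coeff j = Complex.I
  odd_orthonormal : ∀ j k,
    coeff j * coeff k * (B₁ (odd j) (odd k) : ℂ) = if j = k then 1 else 0

/-- The even part `spo(V)₀ = sp(V₀) ⊕ so(V₁)`. -/
abbrev spoEven : Type _ := skewEnd B₀ × skewEnd B₁

/-- The odd part `spo(V)₁`: the pairs `Y = (Y : V₁ → V₀, Y : V₀ → V₁)` such that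
`B(Y v, w) + (-1)^{p(v)} B(v, Y w) = 0` for all homogeneous `v`, `w`. -/
def spoOdd : Submodule ℝ ((V₁ →ₗ[ℝ] V₀) × (V₀ →ₗ[ℝ] V₁)) where
  carrier := {Y | (∀ v w, B₁ (Y.2 v) w + B₀ v (Y.1 w) = 0) ∧
    (∀ w v, B₀ (Y.1 w) v - B₁ w (Y.2 v) = 0)}
  zero_mem' := by simp
  add_mem' := by
    rintro X Y ⟨hX, hX'⟩ ⟨hY, hY'⟩
    refine ⟨fun v w => ?_, fun w v => ?_⟩
    · have h1 := hX v w
      have h2 := hY v w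
      simp only [Prod.snd_add, Prod.fst_add, map_add, LinearMap.add_apply]
      linarith
    · have h1 := hX' w v
      have h2 := hY' w v
      simp only [Prod.snd_add, Prod.fst_add, map_add, LinearMap.add_apply]
      linarith
  smul_mem' := by
    rintro c X ⟨hX, hX'⟩
    refine ⟨fun v w => ?_, fun w v => ?_⟩
    · have h1 := hX v w
      simp only [Prod.smul_snd, Prod.smul_fst, map_smul, LinearMap.smul_apply, smul_eq_mul]
      linear_combination c * h1
    · have h1 := hX' w v
      simp only [Prod.smul_snd, Prod.smul_fst, map_smul, LinearMap.smul_apply, smul_eq_mul]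
      linear_combination c * h1

/-- `𝒰 × so(V₁)`, where `𝒰 ⊆ sp(V₀)` is the set of `A` for which the quadratic form
`v ↦ B₀(v, A v)` on `V₀` is non degenerate. -/
def regularSet : Set (spoEven B₀ B₁) :=
  {X | (B₀.compRight (X.1 : V₀ →L[ℝ] V₀).toLinearMap).Nondegenerate}

/-- `Λ(spo(V)₁^*) ⊗ ℂ`. -/
abbrev CoeffAlgebra : Type _ := ExteriorAlgebra ℂ (spoOdd B₀ B₁ →ₗ[ℝ] ℂ)

/-- `Λ(spo(V)₁^* ⊕ V₁^*) ⊗ ℂ = (Λ(spo(V)₁^*) ⊗ Λ(V₁^*)) ⊗ ℂ`, generated by the odd coordinates on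
`spo(V)` and on `V`. -/
abbrev TotalAlgebra : Type _ :=
  ExteriorAlgebra ℂ ((spoOdd B₀ B₁ →ₗ[ℝ] ℂ) × (V₁ →ₗ[ℝ] ℂ))

variable {B₀ B₁} {r n : ℕ} (b : OrientedSymplecticBasis B₀ B₁ r n)

/-- The odd coordinate `ξ^j`, dual to `f j = coeff j • odd j`. -/
def xi (j : Fin n) : TotalAlgebra B₀ B₁ :=
  ExteriorAlgebra.ι ℂ (0, (b.coeff j)⁻¹ • (Complex.ofRealCLM.toLinearMap ∘ₗ b.odd.coord j))

/-- The derivation `∂/∂ξ^j`, i.e. the contraction with the vector `f j` of `V₁ ⊗ ℂ`. -/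
def dxi (j : Fin n) : Module.End ℂ (TotalAlgebra B₀ B₁) :=
  CliffordAlgebra.contractLeft
    ({ toFun := fun φ => b.coeff j * φ.2 (b.odd j)
       map_add' := fun φ ψ => by simp [mul_add]
       map_smul' := fun c φ => by simp [mul_left_comm] } :
      Module.Dual ℂ ((spoOdd B₀ B₁ →ₗ[ℝ] ℂ) × (V₁ →ₗ[ℝ] ℂ)))

/-- The Berezin integral `φ ↦ (∂/∂ξ^1 ⋯ ∂/∂ξ^n φ)` evaluated at `ξ = 0`, along `V₁`. -/
def berezin (φ : TotalAlgebra B₀ B₁) : CoeffAlgebra B₀ B₁ :=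
  ExteriorAlgebra.map (LinearMap.fst ℂ _ _) ((List.ofFn (dxi b)).prod φ)

/-- For `u ∈ V₀`, the odd linear form `Y ↦ B(u, Y f_j)` on `spo(V)₁`, that is
`∑ₖ B(u, G_k f_j) Z^k` for a basis `G_k` of `spo(V)₁` with dual basis `Z^k`. -/
def formEvenOdd (u : V₀) (j : Fin n) : TotalAlgebra B₀ B₁ :=
  ExteriorAlgebra.ι ℂ
    ({ toFun := fun Y => b.coeff j * (B₀ u (Y.1.1 (b.odd j)) : ℂ)
       map_add' := fun Y Z => by simp [mul_add]
       map_smul' := fun c Y => by simp [mul_left_comm] }, 0)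

/-- For `u ∈ V₀`, the odd linear form `Y ↦ B(f_j, Y u)` on `spo(V)₁`, that is
`∑ₖ B(f_j, G_k u) Z^k`. -/
def formOddEven (u : V₀) (j : Fin n) : TotalAlgebra B₀ B₁ :=
  ExteriorAlgebra.ι ℂ
    ({ toFun := fun Y => b.coeff j * (B₁ (b.odd j) (Y.1.2 u) : ℂ)
       map_add' := fun Y Z => by simp [mul_add]
       map_smul' := fun c Y => by simp [mul_left_comm] }, 0)

/-- The nilpotent part of `B(v, (X + Ξ) v)` at `X = (A, D) ∈ sp(V₀) ⊕ so(V₁)`, where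
`v = u + ∑ⱼ f_j ξ^j` with `u ∈ V₀`, and `Ξ = ∑ₖ G_k Z^k` is the generic point of `spo(V)₁`.
By the rule of signs `B(v, (X + Ξ) v) = ∑ B(g_i, G_k g_j) z^j Z^k z^i`, so that this nilpotent
part is `∑ᵢⱼ B(f_i, D f_j) ξ^j ξ^i + ∑ⱼₖ ξ^j B(u, G_k f_j) Z^k + ∑ⱼₖ B(f_j, G_k u) Z^k ξ^j`;
its body is `B₀(u, A u)`. -/
def momentSoul (u : V₀) (X : spoEven B₀ B₁) : TotalAlgebra B₀ B₁ :=
  (∑ i, ∑ j, (b.coeff i * b.coeff j * (B₁ (b.odd i) (X.2.1 (b.odd j)) : ℂ)) • (xi b j * xi b i))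
    + (∑ j, xi b j * formEvenOdd b u j) + ∑ j, formOddEven b u j * xi b j

/-- `exp(-(i/2) B(v, (X + Ξ) v))`: the exponential of an even element is the ordinary exponential
of its body times the (finite) exponential series of its nilpotent part. -/
def expMoment (u : V₀) (X : spoEven B₀ B₁) : TotalAlgebra B₀ B₁ :=
  Complex.exp (-(Complex.I / 2) * (B₀ u (X.1.1 u) : ℂ)) •
    IsNilpotent.exp ((-(Complex.I / 2)) • momentSoul b u X)

/-- The integral over `spo(V)₀` of the density `ρ · ν` against the function
`exp(-(i/2) B(v, (X + Ξ) v))`, after Berezin integration along `V₁`; this is a function of the even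
coordinates `x` of `v`. It takes values in `Λ(spo(V)₁^*) ⊗ ℂ`, of which we take the component given
by the linear form `l`. -/
def innerIntegral (ν : Measure (spoEven B₀ B₁)) (l : Module.Dual ℂ (CoeffAlgebra B₀ B₁))
    (ρ : spoEven B₀ B₁ → ℝ) (x : Fin r ⊕ Fin r → ℝ) : ℂ :=
  ∫ X, (ρ X : ℂ) * l (berezin b (expMoment b (b.even.equivFun.symm x) X)) ∂ν

/-- `i^{(m-n)/2} ∫_V d_V(v) ∫ ρ(X) exp(-(i/2) B(v, X v)) dν(X)`, where `m = 2r`, and where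
`d_V = (2π)^{-m/2} |dx| ∂/∂ξ^1 ⋯ ∂/∂ξ^n` is the Liouville integral. -/
def pairing (ν : Measure (spoEven B₀ B₁)) (l : Module.Dual ℂ (CoeffAlgebra B₀ B₁))
    (ρ : spoEven B₀ B₁ → ℝ) : ℂ :=
  Complex.I ^ ((2 * (r : ℂ) - n) / 2) *
    (((2 * Real.pi : ℝ) : ℂ) ^ r)⁻¹ * ∫ x, innerIntegral b ν l ρ x

/-- `S` is the superPfaffian as a generalized function on the supermanifold `spo(V)`, that is, as a
generalized function on `spo(V)₀` with values in `Λ(spo(V)₁^*) ⊗ ℂ`; `S l` is its component along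
the linear form `l`. A smooth compactly supported density on `spo(V)₀` is written `ρ · ν` with `ν`
a fixed Haar measure. The integral over `V` defining `S` has to converge. -/
def IsSuperPfaffian (ν : Measure (spoEven B₀ B₁))
    (S : Module.Dual ℂ (CoeffAlgebra B₀ B₁) → 𝓓'((⊤ : Opens (spoEven B₀ B₁)), ℂ)) : Prop :=
  ∀ l (ρ : 𝓓((⊤ : Opens (spoEven B₀ B₁)), ℝ)),
    Integrable (innerIntegral b ν l ρ) ∧ S l ρ = pairing b ν l ρ

end Defs

/-- The singular support of a generalized function `T` on `E`: the points having no open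
neighbourhood in which `T` is a smooth function. -/
def singularSupport {E : Type*} [NormedAddCommGroup E] [NormedSpace ℝ E] [MeasurableSpace E]
    (ν : Measure E) (T : 𝓓'((⊤ : Opens E), ℂ)) : Set E :=
  {X | ¬ ∃ U : Set E, IsOpen U ∧ X ∈ U ∧ ∃ F : E → ℂ, ContDiffOn ℝ ∞ F U ∧
    ∀ ρ : 𝓓((⊤ : Opens E), ℝ), tsupport ρ ⊆ U → T ρ = ∫ Y, (ρ Y : ℂ) * F Y ∂ν}

end SuperPfaffian

end

/-! Write `Q X` for the symmetric matrix of `v ↦ B₀(v, A v)` at `X = (A, D)`. It depends linearly on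
`X`, and every symmetric matrix occurs. After Berezin integration each component of Spf is an
oscillating integral `∫ dx ∫ ρ(X) exp(-(i/2) x·Q(X)x) f(x, X) dν(X)`, whose amplitude `f` is
polynomial in `x` and smooth in `X`, because the odd part of the exponent is nilpotent.

Convergence: choose `Y` with `Q Y = 1`. Integrating by parts, `1 - 2i∂_Y` on the test function
multiplies the inner integral by `1 + |x|²`. The inner integral therefore decays faster than any
power of `|x|`, and the outer integral is continuous in the test function (`oscIntegral_pow`,
`momentDistribution`).

Smoothness where `det Q ≠ 0`: with a Gaussian cutoff the `x`-integral has square `(2π)^m / det(ε +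
iQ)` (`regGaussian_sq`). A local branch of the square root survives as `ε → 0` and gives a smooth
density `G` with `G² det(iQ) = (2π)^m` (`exists_limit_regGaussian`). A factor `x_i x_j` amounts to a
derivative in `X`, and odd monomials integrate to zero (`exists_density_momentDistribution`).

Singularity where `det Q = 0`: the scalar component has an amplitude `p(D)` free of `x`, a multiple
of the Pfaffian of `D`. If it had a continuous density `F` near `X`, then `F² det(iQ) = (c p)²
(2π)^m` at nearby nondegenerate points, and by continuity at degenerate ones too, so `p` would
vanish at the latter (`amplitude_eq_zero_of_continuousOn`). But `D` moves without changing `Q`, and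
since `n` is even the Pfaffian is a nonzero polynomial, which vanishes on no open set
(`exists_oddPfaffian_ne_zero_mem_nhds`). -/

noncomputable section

namespace SuperPfaffian

open Matrix Complex

/-! ### Regularized oscillating Gaussian integrals. -/

section Gaussian

variable {ι : Type*} [Fintype ι]

/-- The oscillating Gaussian `exp(-(i/2) x · M x)`. -/
def phase (M : Matrix ι ι ℝ) (x : ι → ℝ) : ℂ :=
  cexp (-(I / 2) * ((x ⬝ᵥ M *ᵥ x : ℝ) : ℂ))

/-- The Gaussian cutoff `exp(-(ε/2) |x|²)`. -/
def gaussianCutoff (ε : ℝ) (x : ι → ℝ) : ℂ := cexp (-(ε / 2) * ((x ⬝ᵥ x : ℝ) : ℂ))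

/-- The oscillating Gaussian integral `∫ exp(-(i/2) x · M x)`, regularized by a cutoff. -/
def regGaussian (ε : ℝ) (M : Matrix ι ι ℝ) : ℂ := ∫ x, gaussianCutoff ε x * phase M x

theorem norm_phase (M : Matrix ι ι ℝ) (x : ι → ℝ) : ‖phase M x‖ = 1 := by
  rw [phase, Complex.norm_exp]
  simp

theorem phase_neg (M : Matrix ι ι ℝ) (x : ι → ℝ) : phase M (-x) = phase M x := by
  simp [phase, mulVec_neg]

theorem norm_gaussianCutoff (ε : ℝ) (x : ι → ℝ) :
    ‖gaussianCutoff ε x‖ = Real.exp (-(ε / 2) * (x ⬝ᵥ x)) := by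
  rw [gaussianCutoff, Complex.norm_exp]
  congr 1
  rw [← Complex.ofReal_ofNat, ← Complex.ofReal_div, ← Complex.ofReal_neg, ← Complex.ofReal_mul,
    Complex.ofReal_re]

theorem norm_gaussianCutoff_le {ε : ℝ} (hε : 0 < ε) (x : ι → ℝ) : ‖gaussianCutoff ε x‖ ≤ 1 := by
  rw [norm_gaussianCutoff, Real.exp_le_one_iff]
  have : 0 ≤ x ⬝ᵥ x := Finset.sum_nonneg fun i _ => mul_self_nonneg _
  nlinarith [mul_nonneg hε.le this]

theorem continuous_phase : Continuous fun p : Matrix ι ι ℝ × (ι → ℝ) => phase p.1 p.2 := by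
  unfold phase
  refine Complex.continuous_exp.comp (continuous_const.mul (continuous_ofReal.comp ?_))
  exact Continuous.dotProduct continuous_snd (Continuous.matrix_mulVec continuous_fst continuous_snd)

theorem continuous_gaussianCutoff (ε : ℝ) : Continuous (gaussianCutoff (ι := ι) ε) := by
  unfold gaussianCutoff
  refine Complex.continuous_exp.comp (continuous_const.mul (continuous_ofReal.comp ?_))
  exact Continuous.dotProduct continuous_id continuous_id

theorem integrable_gaussianCutoff {ε : ℝ} (hε : 0 < ε) : Integrable (gaussianCutoff (ι := ι) ε) := by
  have h := GaussianFourier.integrable_cexp_neg_mul_sum_add (ι := ι) (b := (ε / 2 : ℝ))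
    (by simpa using hε) (fun _ => 0)
  refine h.congr (Filter.Eventually.of_forall fun x => ?_)
  simp [gaussianCutoff, dotProduct, sq]

theorem integrable_gaussianCutoff_mul_phase {ε : ℝ} (hε : 0 < ε) (M : Matrix ι ι ℝ) :
    Integrable fun x => gaussianCutoff ε x * phase M x := by
  refine (integrable_gaussianCutoff hε).mul_bdd (c := 1) ?_ ?_
  · exact (continuous_phase.comp (Continuous.prodMk_right M)).aestronglyMeasurable
  · exact Filter.Eventually.of_forall fun x => (norm_phase M x).le

theorem continuous_regGaussian {ε : ℝ} (hε : 0 < ε) :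
    Continuous (regGaussian (ι := ι) ε) := by
  have : FirstCountableTopology (Matrix ι ι ℝ) :=
    inferInstanceAs (FirstCountableTopology (ι → ι → ℝ))
  refine continuous_of_dominated (bound := fun x => ‖gaussianCutoff (ι := ι) ε x‖) ?_ ?_ ?_ ?_
  · exact fun M => (integrable_gaussianCutoff_mul_phase hε M).aestronglyMeasurable
  · exact fun M => Filter.Eventually.of_forall fun x => by rw [norm_mul, norm_phase, mul_one]
  · exact (integrable_gaussianCutoff hε).norm
  · exact Filter.Eventually.of_forall fun x =>
      continuous_const.mul (continuous_phase.comp (Continuous.prodMk_left x))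

variable [DecidableEq ι]

theorem measurePreserving_orthogonal {U : Matrix ι ι ℝ} (hU : U ∈ Matrix.orthogonalGroup ι ℝ) :
    MeasurePreserving (Matrix.toLin' U) volume volume := by
  have hdet : |U.det| = 1 := by
    have h : U.det * U.det = 1 := by
      have := congrArg Matrix.det ((Matrix.mem_orthogonalGroup_iff ι ℝ).1 hU)
      simpa [star_eq_conjTranspose] using this
    rcases mul_self_eq_one_iff.1 h with h | h <;> simp [h]
  refine ⟨(LinearMap.continuous_of_finiteDimensional _).measurable, ?_⟩
  rw [Real.map_matrix_volume_pi_eq_smul_volume_pi (by intro h; simp [h] at hdet), abs_inv, hdet]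
  simp

/-- The square of a regularized oscillating Gaussian integral. -/
theorem regGaussian_sq {ε : ℝ} (hε : 0 < ε) {M : Matrix ι ι ℝ} (hM : M.IsSymm) :
    regGaussian ε M ^ 2 * ((ε : ℂ) • (1 : Matrix ι ι ℂ) + I • M.map ofReal).det
      = (2 * Real.pi) ^ Fintype.card ι := by
  have hH : M.IsHermitian := by
    rw [Matrix.IsHermitian, conjTranspose_eq_transpose_of_trivial]; exact hM
  set U : Matrix ι ι ℝ := hH.eigenvectorUnitary.1 with hUdef
  set ev := hH.eigenvalues with hev
  have hU : U ∈ Matrix.orthogonalGroup ι ℝ := hH.eigenvectorUnitary.2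
  have hUU : U * Uᵀ = 1 := (Matrix.mem_orthogonalGroup_iff ι ℝ).1 hU
  have hUU' : Uᵀ * U = 1 := mul_eq_one_comm.1 hUU
  have hsp : M = U * diagonal ev * Uᵀ := by
    have := hH.spectral_theorem
    rw [Unitary.conjStarAlgAut_apply, star_eq_conjTranspose,
      conjTranspose_eq_transpose_of_trivial] at this
    exact this
  have hre : ∀ i, 0 < (((ε : ℂ) + I * ev i) / 2).re := by
    intro i
    simpa [Complex.div_re] using hε
  have hne : ∀ i, (ε : ℂ) + I * ev i ≠ 0 := by
    intro i h
    have := hre i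
    rw [h] at this
    simp at this
  -- Orthogonal diagonalization preserves both Lebesgue measure and the cutoff, so the integral
  -- splits into one-dimensional Gaussians.
  have hG : regGaussian ε M = ∏ i, (Real.pi / (((ε : ℂ) + I * ev i) / 2)) ^ (1 / 2 : ℂ) := by
    have hcomp := (measurePreserving_orthogonal hU).integral_comp
      (by
        have hdet : U.det ≠ 0 := fun h => by
          have := congrArg Matrix.det hUU
          simp [h] at this
        exact ((Matrix.toLin'OfInv hUU' hUU).toContinuousLinearEquiv.toHomeomorph).measurableEmbedding)
      (fun x => gaussianCutoff ε x * phase M x)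
    rw [regGaussian, ← hcomp]
    have hint : ∀ y : ι → ℝ, gaussianCutoff ε (Matrix.toLin' U y) * phase M (Matrix.toLin' U y)
        = ∏ i, cexp (-(((ε : ℂ) + I * ev i) / 2) * (y i : ℂ) ^ 2) := by
      intro y
      have h1 : (U *ᵥ y) ⬝ᵥ (U *ᵥ y) = ∑ i, y i ^ 2 := by
        rw [dotProduct_mulVec, vecMul_mulVec, hUU', vecMul_one]
        simp [dotProduct, sq]
      have h2 : (U *ᵥ y) ⬝ᵥ (M *ᵥ (U *ᵥ y)) = ∑ i, ev i * y i ^ 2 := by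
        have : M *ᵥ (U *ᵥ y) = U *ᵥ (diagonal ev *ᵥ y) := by
          rw [hsp, mulVec_mulVec, mulVec_mulVec, Matrix.mul_assoc, hUU', Matrix.mul_one]
        rw [this, dotProduct_mulVec, vecMul_mulVec, hUU', vecMul_one]
        simp only [dotProduct, mulVec_diagonal]
        exact Finset.sum_congr rfl fun i _ => by ring
      rw [Matrix.toLin'_apply, gaussianCutoff, phase, h1, h2, ← Complex.exp_add, ← Complex.exp_sum]
      congr 1
      push_cast
      rw [Finset.mul_sum, Finset.mul_sum, ← Finset.sum_add_distrib]
      exact Finset.sum_congr rfl fun i _ => by ring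
    simp_rw [hint]
    rw [integral_fintype_prod_volume_eq_prod
      (fun i (t : ℝ) => cexp (-(((ε : ℂ) + I * ev i) / 2) * (t : ℂ) ^ 2))]
    exact Finset.prod_congr rfl fun i _ => integral_gaussian_complex (hre i)
  have hdet : ((ε : ℂ) • (1 : Matrix ι ι ℂ) + I • M.map ofReal).det
      = ∏ i, ((ε : ℂ) + I * ev i) := by
    have hV : U.map ofReal * Uᵀ.map ofReal = (1 : Matrix ι ι ℂ) := by
      have := congrArg (fun A : Matrix ι ι ℝ => A.map (ofRealHom : ℝ →+* ℂ)) hUU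
      rwa [Matrix.map_mul, Matrix.map_one _ (map_zero _) (map_one _)] at this
    have hMap : M.map ofReal = U.map ofReal * diagonal (fun i => (ev i : ℂ)) * Uᵀ.map ofReal := by
      have := congrArg (fun A : Matrix ι ι ℝ => A.map (ofRealHom : ℝ →+* ℂ)) hsp
      rwa [Matrix.map_mul, Matrix.map_mul, Matrix.diagonal_map (map_zero _)] at this
    have : (ε : ℂ) • (1 : Matrix ι ι ℂ) + I • M.map ofReal
        = U.map ofReal * diagonal (fun i => (ε : ℂ) + I * ev i) * Uᵀ.map ofReal := by
      have hd : diagonal (fun i => (ε : ℂ) + I * ev i)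
          = (ε : ℂ) • (1 : Matrix ι ι ℂ) + I • diagonal (fun i => (ev i : ℂ)) := by
        ext i j
        by_cases h : i = j
        · subst h; simp
        · simp [h]
      rw [hd, hMap, Matrix.mul_add, Matrix.add_mul, Matrix.mul_smul, Matrix.mul_one,
        Matrix.smul_mul, hV, Matrix.mul_smul, Matrix.smul_mul]
    rw [this, det_mul, det_mul, mul_comm (det _) (det _), mul_assoc, ← det_mul, hV, det_one,
      mul_one, det_diagonal]
  rw [hG, hdet, ← Finset.prod_pow, ← Finset.prod_mul_distrib]
  rw [Finset.prod_congr rfl (g := fun _ => (2 * Real.pi : ℂ)), Finset.prod_const, Finset.card_univ]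
  intro i _
  -- Squaring cancels the exponent `1/2`, so no branch of the root has to be tracked across the
  -- product.
  rw [← Complex.cpow_nat_mul]
  have := hne i
  norm_num
  field_simp

end Gaussian

end SuperPfaffian
end

/-! ### Smooth local limit of the regularized Gaussians. -/

noncomputable section

namespace SuperPfaffian

open Matrix Complex Filter Topology

theorem contDiff_entry {ι E : Type*} [NormedAddCommGroup E] [NormedSpace ℝ E]
    [FiniteDimensional ℝ E] (Q : E →ₗ[ℝ] Matrix ι ι ℝ) (i j : ι) : ContDiff ℝ ∞ fun X => Q X i j :=
  (((Matrix.entryLinearMap ℝ ℝ i j).comp Q).toContinuousLinearMap).contDiff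

section LocalBranch

variable {ι : Type*} [Fintype ι] [DecidableEq ι]
  {E : Type*} [NormedAddCommGroup E] [NormedSpace ℝ E] [FiniteDimensional ℝ E]

/-- The determinant of `ε + i M`. -/
def regDet (ε : ℝ) (M : Matrix ι ι ℝ) : ℂ :=
  ((ε : ℂ) • (1 : Matrix ι ι ℂ) + I • M.map ofReal).det

theorem regDet_zero (M : Matrix ι ι ℝ) : regDet 0 M = I ^ Fintype.card ι * (M.det : ℂ) := by
  have : ((M.map ofReal).det : ℂ) = (M.det : ℂ) := (RingHom.map_det ofRealHom M).symm
  simp [regDet, this]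

theorem continuous_regDet : Continuous fun p : ℝ × Matrix ι ι ℝ => regDet p.1 p.2 := by
  unfold regDet
  refine Continuous.matrix_det ?_
  refine Continuous.add ?_ ?_
  · exact (continuous_ofReal.comp continuous_fst).smul continuous_const
  · exact (continuous_snd.matrix_map continuous_ofReal).const_smul I

variable (Q : E →ₗ[ℝ] Matrix ι ι ℝ)

theorem contDiff_regDet (ε : ℝ) : ContDiff ℝ ∞ fun X => regDet ε (Q X) := by
  simp only [regDet, det_apply]
  refine ContDiff.sum fun σ _ => ContDiff.const_smul _ (contDiff_prod fun i _ => ?_)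
  simp only [Matrix.add_apply, Matrix.smul_apply, map_apply]
  exact contDiff_const.add ((ofRealCLM.contDiff.comp (contDiff_entry Q _ _)).const_smul I)

theorem two_pi_pow_ne_zero (k : ℕ) : (2 * Real.pi : ℂ) ^ k ≠ 0 :=
  pow_ne_zero _ (mul_ne_zero two_ne_zero (ofReal_ne_zero.2 Real.pi_ne_zero))

theorem mem_slitPlane_of_norm_sub_one_lt {z : ℂ} (hz : ‖z - 1‖ < 1 / 2) : z ∈ slitPlane := by
  refine Or.inl ?_
  have h := (abs_re_le_norm (z - 1)).trans_lt hz
  rw [sub_re, one_re, abs_lt] at h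
  linarith [h.1]

/-- Near a point where `Q` is non degenerate, the regularized Gaussian integrals have a smooth
limit along some sequence, which is a square root of `(2π)^m / det (i Q)`. -/
theorem exists_limit_regGaussian (hQ : ∀ X, (Q X).IsSymm) {X₀ : E} (hX₀ : (Q X₀).det ≠ 0) :
    ∃ U : Set E, IsOpen U ∧ X₀ ∈ U ∧ ∃ G : E → ℂ, ContDiffOn ℝ ∞ G U ∧
      (∀ X ∈ U, G X ^ 2 * (I ^ Fintype.card ι * ((Q X).det : ℂ)) = (2 * Real.pi) ^ Fintype.card ι) ∧
      ∃ ε : ℕ → ℝ, (∀ k, 0 < ε k) ∧ Tendsto ε atTop (𝓝 0) ∧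
        (∃ C, ∀ k, ∀ X ∈ U, ‖regGaussian (ε k) (Q X)‖ ≤ C) ∧
        ∀ X ∈ U, Tendsto (fun k => regGaussian (ε k) (Q X)) atTop (𝓝 (G X)) := by
  have hQc : Continuous Q := Q.continuous_of_finiteDimensional
  have hDc : Continuous fun p : ℝ × E => regDet p.1 (Q p.2) :=
    continuous_regDet.comp (continuous_fst.prodMk (hQc.comp continuous_snd))
  set D : ℝ → E → ℂ := fun ε X => regDet ε (Q X) with hD
  have hDc1 : ∀ X, Continuous fun ε => D ε X := fun X => hDc.comp (Continuous.prodMk_left X)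
  have hD0 : D 0 X₀ ≠ 0 := by
    simp only [hD, regDet_zero]
    exact mul_ne_zero (pow_ne_zero _ I_ne_zero) (ofReal_ne_zero.2 hX₀)
  have hsq : ∀ ε > 0, ∀ X, regGaussian ε (Q X) ^ 2 * D ε X = (2 * Real.pi) ^ Fintype.card ι :=
    fun ε hε X => regGaussian_sq hε (hQ X)
  have hDne : ∀ ε > 0, ∀ X, D ε X ≠ 0 := fun ε hε X h => by
    have := hsq ε hε X
    rw [h, mul_zero] at this
    exact two_pi_pow_ne_zero _ this.symm
  have hgne : ∀ ε > 0, ∀ X, regGaussian ε (Q X) ≠ 0 := fun ε hε X h => by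
    have := hsq ε hε X
    rw [h, zero_pow two_ne_zero, zero_mul] at this
    exact two_pi_pow_ne_zero _ this.symm
  -- This ratio is close to `1` near `(0, X₀)`, so the principal logarithm supplies a square root of
  -- its inverse there.
  set R : ℝ → E → ℂ := fun ε X => D ε X / D ε X₀ with hR
  have hRc : ContinuousAt (fun p : ℝ × E => R p.1 p.2) (0, X₀) := by
    refine ContinuousAt.div hDc.continuousAt ?_ hD0
    exact (hDc.comp (continuous_fst.prodMk continuous_const)).continuousAt
  have hnear : ∀ᶠ p : ℝ × E in 𝓝 (0, X₀), ‖R p.1 p.2 - 1‖ < 1 / 2 := by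
    have h1 : Tendsto (fun p : ℝ × E => ‖R p.1 p.2 - 1‖) (𝓝 (0, X₀)) (𝓝 0) := by
      have := (Tendsto.sub_const hRc.tendsto 1).norm
      simpa [hR, div_self hD0] using this
    exact h1.eventually (gt_mem_nhds (by norm_num))
  obtain ⟨δ, hδ, hball⟩ := Metric.eventually_nhds_iff_ball.1 hnear
  have hRb : ∀ ε, 0 ≤ ε → ε < δ → ∀ X ∈ Metric.ball X₀ δ, ‖R ε X - 1‖ < 1 / 2 := by
    intro ε h0 h1 X hX
    refine hball (ε, X) ?_
    rw [Metric.mem_ball, Prod.dist_eq]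
    refine max_lt ?_ hX
    simpa [abs_of_nonneg h0] using h1
  set s : ℝ → E → ℂ := fun ε X => cexp (-(1 / 2) * log (R ε X)) with hs
  have hssq : ∀ ε, 0 ≤ ε → ε < δ → ∀ X ∈ Metric.ball X₀ δ, s ε X ^ 2 * R ε X = 1 := by
    intro ε h0 h1 X hX
    have hne := slitPlane_ne_zero (mem_slitPlane_of_norm_sub_one_lt (hRb ε h0 h1 X hX))
    have : s ε X ^ 2 = cexp (-log (R ε X)) := by
      rw [hs, ← Complex.exp_nat_mul]
      congr 1
      push_cast
      ring
    rw [this, Complex.exp_neg, exp_log hne, inv_mul_cancel₀ hne]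
  -- Both sides are continuous square roots of the same nonvanishing function on a connected ball,
  -- and they agree at `X₀`.
  have hbranch : ∀ ε, 0 < ε → ε < δ → ∀ X ∈ Metric.ball X₀ δ,
      regGaussian ε (Q X) = regGaussian ε (Q X₀) * s ε X := by
    intro ε h0 h1
    refine (convex_ball X₀ δ).isPreconnected.eq_of_sq_eq
      (f := fun X => regGaussian ε (Q X)) (g := fun X => regGaussian ε (Q X₀) * s ε X)
      ((continuous_regGaussian h0).comp hQc).continuousOn ?_ ?_ ?_ (Metric.mem_ball_self hδ) ?_
    · refine continuousOn_const.mul (Complex.continuous_exp.comp_continuousOn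
        (continuousOn_const.mul (ContinuousOn.clog ?_ ?_)))
      · exact ((hDc.comp (Continuous.prodMk_right ε)).div_const _).continuousOn
      · exact fun X hX => mem_slitPlane_of_norm_sub_one_lt (hRb ε h0.le h1 X hX)
    · intro X hX
      have e1 := hsq ε h0 X
      have e2 := hsq ε h0 X₀
      have e3 := hssq ε h0.le h1 X hX
      have n1 := hDne ε h0 X
      have n2 := hDne ε h0 X₀
      simp only [hR] at e3
      simp only [Pi.pow_apply]
      refine mul_right_cancel₀ n1 ?_
      rw [e1, ← e2, mul_pow]
      field_simp at e3
      linear_combination (-regGaussian ε (Q X₀) ^ 2) * e3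
    · intro X _
      exact mul_ne_zero (hgne ε h0 X₀) (Complex.exp_ne_zero _)
    · have : R ε X₀ = 1 := div_self (hDne ε h0 X₀)
      simp [hs, this]
  have hsb : ∀ ε, 0 ≤ ε → ε < δ → ∀ X ∈ Metric.ball X₀ δ, ‖s ε X‖ ≤ 2 := by
    intro ε h0 h1 X hX
    have e := congrArg norm (hssq ε h0 h1 X hX)
    have h2 := hRb ε h0 h1 X hX
    rw [norm_mul, norm_pow, norm_one] at e
    have h3 : 1 / 2 ≤ ‖R ε X‖ := by
      have := norm_sub_norm_le (1 : ℂ) (R ε X)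
      rw [norm_one, norm_sub_rev] at this
      linarith
    by_contra! h
    nlinarith [norm_nonneg (s ε X)]
  -- The shift by `2` keeps every term strictly below `δ`, including the one for `k = 0`.
  set e0 : ℕ → ℝ := fun k => δ / (k + 2) with he0
  have he0pos : ∀ k, 0 < e0 k := fun k => by positivity
  have he0lt : ∀ k, e0 k < δ := fun k => by
    rw [he0]
    exact div_lt_self hδ (by have : (0 : ℝ) ≤ k := Nat.cast_nonneg k; linarith)
  have he0lim : Tendsto e0 atTop (𝓝 0) := by
    refine Tendsto.const_div_atTop ?_ δ
    exact tendsto_atTop_add_const_right _ _ tendsto_natCast_atTop_atTop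
  have hDlim : Tendsto (fun k => D (e0 k) X₀) atTop (𝓝 (D 0 X₀)) :=
    ((hDc1 X₀).tendsto 0).comp he0lim
  have hbd : Bornology.IsBounded (Set.range fun k => regGaussian (e0 k) (Q X₀)) := by
    have h1 : Tendsto (fun k => ‖((2 * Real.pi : ℂ) ^ Fintype.card ι) / D (e0 k) X₀‖) atTop
        (𝓝 ‖((2 * Real.pi : ℂ) ^ Fintype.card ι) / D 0 X₀‖) :=
      (Tendsto.div tendsto_const_nhds hDlim hD0).norm
    obtain ⟨C, hC⟩ := h1.bddAbove_range
    refine (Metric.isBounded_iff_subset_closedBall 0).2 ⟨max C 1, ?_⟩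
    rintro _ ⟨k, rfl⟩
    have h2 := hC ⟨k, rfl⟩
    simp only [← hsq (e0 k) (he0pos k) X₀, mul_div_assoc, div_self (hDne _ (he0pos k) X₀), mul_one,
      norm_pow] at h2
    rw [mem_closedBall_zero_iff]
    by_contra! h
    have h4 := (max_lt_iff.1 h)
    nlinarith
  -- Only the square of the value at `X₀` is known to converge. Boundedness yields a convergent
  -- subsequence, and the sign of its limit `γ` is irrelevant later.
  obtain ⟨γ, -, φ, hφ, hγ⟩ := tendsto_subseq_of_bounded hbd (fun k => Set.mem_range_self k)
  obtain ⟨C, hC⟩ := hbd.exists_norm_le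
  have hlim : ∀ X ∈ Metric.ball X₀ δ,
      Tendsto (fun k => regGaussian (e0 (φ k)) (Q X)) atTop (𝓝 (γ * s 0 X)) := by
    intro X hX
    have hslim : Tendsto (fun k => s (e0 (φ k)) X) atTop (𝓝 (s 0 X)) := by
      have hc : ContinuousAt (fun ε => s ε X) 0 := by
        refine (Complex.continuous_exp.continuousAt).comp
          (continuousAt_const.mul (ContinuousAt.clog ?_ ?_))
        · exact (hDc1 X).continuousAt.div (hDc1 X₀).continuousAt hD0
        · exact mem_slitPlane_of_norm_sub_one_lt (hRb 0 le_rfl hδ X hX)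
      exact hc.tendsto.comp (he0lim.comp hφ.tendsto_atTop)
    refine (hγ.mul hslim).congr fun k => ?_
    exact (hbranch _ (he0pos _) (he0lt _) X hX).symm
  refine ⟨Metric.ball X₀ δ, Metric.isOpen_ball, Metric.mem_ball_self hδ, fun X => γ * s 0 X,
    ?_, ?_, fun k => e0 (φ k), fun k => he0pos _, he0lim.comp hφ.tendsto_atTop, ⟨C * 2, ?_⟩, hlim⟩
  · refine contDiffOn_const.mul (Complex.contDiff_exp.comp_contDiffOn
      (contDiffOn_const.mul ?_))
    intro X hX
    refine ContDiffAt.contDiffWithinAt ?_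
    have h1 : ContDiffAt ℝ ∞ log (R 0 X) :=
      (contDiffAt_log (mem_slitPlane_of_norm_sub_one_lt (hRb 0 le_rfl hδ X hX))).restrict_scalars ℝ
    have h2 : ContDiffAt ℝ ∞ (fun X => R 0 X) X :=
      ((contDiff_regDet Q 0).div_const _).contDiffAt
    exact h1.comp X h2
  · intro X hX
    have h1 : Tendsto (fun k => regGaussian (e0 (φ k)) (Q X) ^ 2 * D (e0 (φ k)) X) atTop
        (𝓝 ((γ * s 0 X) ^ 2 * D 0 X)) :=
      ((hlim X hX).pow 2).mul (((hDc1 X).tendsto 0).comp (he0lim.comp hφ.tendsto_atTop))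
    simp only [hsq _ (he0pos _)] at h1
    have h2 := tendsto_nhds_unique h1 tendsto_const_nhds
    simpa only [hD, regDet_zero] using h2
  · intro k X hX
    rw [hbranch _ (he0pos _) (he0lt _) X hX, norm_mul]
    exact mul_le_mul (hC _ ⟨_, rfl⟩) (hsb _ (he0pos _).le (he0lt _) X hX) (norm_nonneg _)
      ((norm_nonneg _).trans (hC _ ⟨φ k, rfl⟩))

end LocalBranch

end SuperPfaffian
end

/-! ### Operations on test functions and integration by parts. -/

noncomputable section

namespace SuperPfaffian

open Matrix Complex Filter Topology

section TestFunctions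

variable {E : Type*} [NormedAddCommGroup E] [NormedSpace ℝ E]

/-- Multiplication of test functions by a smooth function. -/
def mulSmooth {g : E → ℂ} (hg : ContDiff ℝ ∞ g) :
    𝓓((⊤ : Opens E), ℂ) →L[ℂ] 𝓓((⊤ : Opens E), ℂ) :=
  TestFunction.limitCLM ℂ
    (fun φ => ⟨fun X => φ X * g X, φ.contDiff.mul hg, φ.hasCompactSupport.mul_right, by simp⟩)
    (fun K hK => (TestFunction.ofSupportedInCLM ℂ hK).comp
      (ContDiffMapSupportedIn.bilinLeftCLM (K := K) (ContinuousLinearMap.mul ℂ ℂ) hg))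
    (fun K hK f => by ext X; rfl)

theorem mulSmooth_apply {g : E → ℂ} (hg : ContDiff ℝ ∞ g) (φ : 𝓓((⊤ : Opens E), ℂ)) (X : E) :
    mulSmooth hg φ X = φ X * g X := rfl

/-- The derivation `-2i ∂_Y` on test functions. -/
def derivOp (Y : E) : 𝓓((⊤ : Opens E), ℂ) →L[ℂ] 𝓓((⊤ : Opens E), ℂ) :=
  (mulSmooth (contDiff_const (c := -2 * I))).comp (TestFunction.lineDerivCLM ℂ Y)

theorem derivOp_apply (Y : E) (φ : 𝓓((⊤ : Opens E), ℂ)) (X : E) :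
    derivOp Y φ X = -2 * I * fderiv ℝ φ X Y := by
  have : (TestFunction.lineDerivCLM ℂ Y φ : 𝓓((⊤ : Opens E), ℂ)) X = fderiv ℝ φ X Y := by
    rw [TestFunction.lineDerivCLM_eq_fderivCLM, TestFunction.fderivCLM_apply, if_pos (by simp)]
  rw [derivOp, ContinuousLinearMap.comp_apply, mulSmooth_apply, this, mul_comm]

theorem tsupport_derivOp_subset (Y : E) (φ : 𝓓((⊤ : Opens E), ℂ)) :
    tsupport (derivOp Y φ) ⊆ tsupport φ := by
  refine closure_minimal (fun X hX => ?_) (isClosed_tsupport _)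
  by_contra h
  refine hX ?_
  rw [derivOp_apply, fderiv_of_notMem_tsupport ℝ h]
  simp

theorem tsupport_pow_one_add_derivOp_subset (Y : E) (N : ℕ) (φ : 𝓓((⊤ : Opens E), ℂ)) :
    tsupport (((1 + derivOp Y) ^ N) φ) ⊆ tsupport φ := by
  induction N with
  | zero => simp
  | succ N ih =>
    rw [pow_succ']
    have h : ((1 + derivOp Y) * (1 + derivOp Y) ^ N) φ
        = ((1 + derivOp Y) ^ N) φ + derivOp Y (((1 + derivOp Y) ^ N) φ) := by
      simp
    rw [h]
    refine Set.Subset.trans ?_ ih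
    refine (tsupport_add _ _).trans (Set.union_subset subset_rfl (tsupport_derivOp_subset _ _))

theorem TestFunction_mul_continuous {φ : 𝓓((⊤ : Opens E), ℂ)} {F : E → ℂ} {U : Set E}
    (hU : IsOpen U) (hF : ContinuousOn F U) (hφ : tsupport φ ⊆ U) :
    Continuous fun X => φ X * F X :=
  (φ.continuous.continuousOn.mul hF).continuous_of_tsupport_subset hU
    ((tsupport_mul_subset_left).trans hφ)

variable [MeasurableSpace E] [BorelSpace E] (μ : Measure E)

theorem TestFunction_mul_integrable [IsFiniteMeasureOnCompacts μ]
    {φ : 𝓓((⊤ : Opens E), ℂ)} {F : E → ℂ} {U : Set E}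
    (hU : IsOpen U) (hF : ContinuousOn F U) (hφ : tsupport φ ⊆ U) :
    Integrable (fun X => φ X * F X) μ :=
  (TestFunction_mul_continuous hU hF hφ).integrable_of_hasCompactSupport φ.hasCompactSupport.mul_right

/-- Integration by parts, which turns `-2i` into `2i`. It shows that composing a distribution with
`derivOp Y` replaces a density `F` by `2i ∂_Y F`. -/
theorem integral_derivOp_mul [FiniteDimensional ℝ E] [μ.IsAddHaarMeasure] (Y : E) {φ : 𝓓((⊤ : Opens E), ℂ)} {F : E → ℂ}
    {U : Set E} (hU : IsOpen U) (hF : ContDiffOn ℝ ∞ F U) (hφ : tsupport φ ⊆ U) :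
    ∫ X, derivOp Y φ X * F X ∂μ = ∫ X, φ X * (2 * I * fderiv ℝ F X Y) ∂μ := by
  have hF' : ContinuousOn (fun X => fderiv ℝ F X Y) U :=
    (hF.continuousOn_fderiv_of_isOpen hU (by simp)).clm_apply continuousOn_const
  have h1 : Integrable (fun X => φ X * fderiv ℝ F X Y) μ :=
    TestFunction_mul_integrable μ hU hF' hφ
  have h2 : Integrable (fun X => derivOp Y φ X * F X) μ :=
    TestFunction_mul_integrable μ hU hF.continuousOn ((tsupport_derivOp_subset Y φ).trans hφ)
  have h3 : Integrable (fun X => φ X * F X) μ :=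
    TestFunction_mul_integrable μ hU hF.continuousOn hφ
  have h4 : Integrable (fun X => fderiv ℝ φ X Y * F X) μ := by
    refine (h2.const_mul (I / 2)).congr (Eventually.of_forall fun X => ?_)
    simp only [derivOp_apply]
    linear_combination (-fderiv ℝ φ X Y * F X) * I_sq
  have key := integral_mul_fderiv_eq_neg_fderiv_mul_of_integrable (μ := μ) (v := Y) (f := φ) (g := F)
    h4 h1 h3 (fun X _ => φ.contDiff.differentiable (by simp) X)
    (fun X hX => (hF.differentiableOn (by simp)).differentiableAt (hU.mem_nhds (hφ hX)))
  have e1 : (fun X => derivOp Y φ X * F X) = fun X => (-2 * I) * (fderiv ℝ φ X Y * F X) := by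
    ext X; rw [derivOp_apply]; ring
  have e2 : (fun X => φ X * (2 * I * fderiv ℝ F X Y))
      = fun X => (2 * I) * (φ X * fderiv ℝ F X Y) := by
    ext X; ring
  rw [e1, e2, integral_const_mul, integral_const_mul, key]
  ring

end TestFunctions

/-! ### Decay of oscillating integrals and the distributions they define. -/

section OscIntegral

variable {ι : Type*} [Fintype ι] {E : Type*} [NormedAddCommGroup E] [NormedSpace ℝ E]
  (Q : E →ₗ[ℝ] Matrix ι ι ℝ)

/-- The linear form `X ↦ x · Q(X) x`. -/
def quadForm (x : ι → ℝ) : E →ₗ[ℝ] ℝ where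
  toFun X := x ⬝ᵥ Q X *ᵥ x
  map_add' X Y := by simp [add_mulVec]
  map_smul' c X := by simp [smul_mulVec]

theorem quadForm_apply (x : ι → ℝ) (X : E) : quadForm Q x X = x ⬝ᵥ Q X *ᵥ x := rfl

theorem phase_eq (x : ι → ℝ) (X : E) :
    phase (Q X) x = cexp (-(I / 2) * (quadForm Q x X : ℂ)) := rfl

section

variable [FiniteDimensional ℝ E]

theorem contDiff_phase (x : ι → ℝ) : ContDiff ℝ ∞ fun X => phase (Q X) x :=
  Complex.contDiff_exp.comp (contDiff_const.mul
    (ofRealCLM.contDiff.comp (quadForm Q x).toContinuousLinearMap.contDiff))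

theorem fderiv_phase (x : ι → ℝ) (X Y : E) :
    fderiv ℝ (fun X => phase (Q X) x) X Y = -(I / 2) * (quadForm Q x Y : ℂ) * phase (Q X) x := by
  have h : HasFDerivAt (fun X => -(I / 2) * (quadForm Q x X : ℂ))
      ((-(I / 2)) • (ofRealCLM.comp (quadForm Q x).toContinuousLinearMap)) X :=
    (ofRealCLM.comp (quadForm Q x).toContinuousLinearMap).hasFDerivAt.const_mul _
  have h2 := h.cexp
  have h3 : fderiv ℝ (fun X => phase (Q X) x) X = _ := h2.fderiv
  rw [h3, phase_eq]
  simp [mul_comm]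

end

variable [MeasurableSpace E] (μ : Measure E)

/-- The oscillating integral `∫ φ(X) exp(-(i/2) x · Q(X) x) dμ(X)`. -/
def oscIntegral (φ : E → ℂ) (x : ι → ℝ) : ℂ := ∫ X, φ X * phase (Q X) x ∂μ

theorem oscIntegral_neg (φ : E → ℂ) (x : ι → ℝ) : oscIntegral Q μ φ (-x) = oscIntegral Q μ φ x := by
  simp only [oscIntegral, phase_neg]

theorem norm_oscIntegral_le (φ : E → ℂ) (x : ι → ℝ) :
    ‖oscIntegral Q μ φ x‖ ≤ ∫ X, ‖φ X‖ ∂μ := by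
  refine (norm_integral_le_integral_norm _).trans (le_of_eq ?_)
  simp only [norm_mul, norm_phase, mul_one]

theorem oscIntegral_smul (c : ℂ) (φ : 𝓓((⊤ : Opens E), ℂ)) (x : ι → ℝ) :
    oscIntegral Q μ (c • φ : 𝓓((⊤ : Opens E), ℂ)) x = c * oscIntegral Q μ φ x := by
  rw [oscIntegral, oscIntegral, ← integral_const_mul]
  congr 1
  ext X
  simp [mul_assoc]

variable [FiniteDimensional ℝ E] [BorelSpace E]

theorem continuous_oscIntegral [IsFiniteMeasureOnCompacts μ] (φ : 𝓓((⊤ : Opens E), ℂ)) :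
    Continuous (oscIntegral Q μ φ) := by
  refine continuous_of_dominated (bound := fun X => ‖φ X‖) ?_ ?_ ?_ ?_
  · exact fun x => (φ.continuous.mul (contDiff_phase Q x).continuous).aestronglyMeasurable
  · exact fun x => Eventually.of_forall fun X => by rw [norm_mul, norm_phase, mul_one]
  · exact (φ.continuous.integrable_of_hasCompactSupport φ.hasCompactSupport).norm
  · exact Eventually.of_forall fun X =>
      continuous_const.mul (continuous_phase.comp (Continuous.prodMk_right _))

/-- The normalization `-2i` in `derivOp` is made for this: the phase contributes `-i/2`, and `2i ·
(-i/2) = 1`. -/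
theorem oscIntegral_derivOp [μ.IsAddHaarMeasure] (Y : E) (φ : 𝓓((⊤ : Opens E), ℂ)) (x : ι → ℝ) :
    oscIntegral Q μ (derivOp Y φ) x = (x ⬝ᵥ Q Y *ᵥ x : ℝ) * oscIntegral Q μ φ x := by
  rw [oscIntegral, integral_derivOp_mul μ Y isOpen_univ (contDiff_phase Q x).contDiffOn
    (Set.subset_univ _), oscIntegral, ← integral_const_mul]
  congr 1
  ext X
  rw [fderiv_phase, quadForm_apply]
  linear_combination (-((x ⬝ᵥ Q Y *ᵥ x : ℝ) : ℂ) * phase (Q X) x * φ X) * I_sq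

theorem oscIntegral_add [IsFiniteMeasureOnCompacts μ] (φ ψ : 𝓓((⊤ : Opens E), ℂ)) (x : ι → ℝ) :
    oscIntegral Q μ (φ + ψ : 𝓓((⊤ : Opens E), ℂ)) x = oscIntegral Q μ φ x + oscIntegral Q μ ψ x := by
  rw [oscIntegral, oscIntegral, oscIntegral, ← integral_add]
  · congr 1
    ext X
    simp [add_mul]
  · exact TestFunction_mul_integrable μ isOpen_univ (contDiff_phase Q x).continuous.continuousOn
      (Set.subset_univ _)
  · exact TestFunction_mul_integrable μ isOpen_univ (contDiff_phase Q x).continuous.continuousOn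
      (Set.subset_univ _)

/-- Source of all the decay: the left side is bounded in `x` for every `N`, so the oscillating
integral is `O((1 + |x|²)^(-N))`. -/
theorem oscIntegral_pow [μ.IsAddHaarMeasure] {Y : E} (hY : ∀ x, x ⬝ᵥ Q Y *ᵥ x = x ⬝ᵥ x) (N : ℕ)
    (φ : 𝓓((⊤ : Opens E), ℂ)) (x : ι → ℝ) :
    oscIntegral Q μ (((1 + derivOp Y) ^ N) φ) x
      = ((1 + x ⬝ᵥ x : ℝ) : ℂ) ^ N * oscIntegral Q μ φ x := by
  induction N with
  | zero => simp
  | succ N ih =>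
    have h : ((1 + derivOp Y) ^ (N + 1)) φ
        = ((1 + derivOp Y) ^ N) φ + derivOp Y (((1 + derivOp Y) ^ N) φ) := by
      rw [pow_succ']; simp
    rw [h, oscIntegral_add, oscIntegral_derivOp, ih, hY]
    push_cast
    ring

/-- The monomial of exponents given by a list of indices. -/
def monomialFun (w : List ι) (x : ι → ℝ) : ℝ := (w.map x).prod

theorem continuous_monomialFun {ι : Type*} (w : List ι) : Continuous (monomialFun w) := by
  unfold monomialFun
  exact continuous_list_prod _ fun i _ => continuous_apply i

theorem abs_monomialFun_le (w : List ι) (x : ι → ℝ) :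
    |monomialFun w x| ≤ (1 + x ⬝ᵥ x) ^ w.length := by
  induction w with
  | nil => simp [monomialFun]
  | cons i w ih =>
    have h1 : |x i| ≤ 1 + x ⬝ᵥ x := by
      have : x i * x i ≤ x ⬝ᵥ x :=
        Finset.single_le_sum (f := fun i => x i * x i) (fun i _ => mul_self_nonneg _)
          (Finset.mem_univ i)
      have h2 := abs_mul_abs_self (x i)
      nlinarith [sq_nonneg (|x i| - 1)]
    rw [List.length_cons, pow_succ', monomialFun, List.map_cons, List.prod_cons, abs_mul]
    exact mul_le_mul h1 ih (abs_nonneg _) ((abs_nonneg _).trans h1)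

/-- The norm on `ι → ℝ` is the sup norm. This compares it with the Euclidean square length that the
integration by parts produces. -/
theorem sq_norm_le_dotProduct (x : ι → ℝ) : ‖x‖ ^ 2 ≤ x ⬝ᵥ x := by
  have h0 : 0 ≤ x ⬝ᵥ x := Finset.sum_nonneg fun i _ => mul_self_nonneg _
  rw [← Real.sqrt_le_sqrt_iff h0, Real.sqrt_sq (norm_nonneg _)]
  refine (pi_norm_le_iff_of_nonneg (Real.sqrt_nonneg _)).2 fun i => ?_
  rw [Real.norm_eq_abs]
  refine Real.abs_le_sqrt ?_
  rw [sq]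
  exact Finset.single_le_sum (f := fun i => x i * x i) (fun i _ => mul_self_nonneg _)
    (Finset.mem_univ i)

theorem integrable_inv_one_add_norm_sq_pow :
    Integrable fun x : ι → ℝ => ((1 + ‖x‖ ^ 2) ^ (Fintype.card ι + 1))⁻¹ := by
  -- The exponent `2(card ι + 1)` exceeds the dimension `card ι`.
  have h := integrable_rpow_neg_one_add_norm_sq (E := ι → ℝ) (μ := volume)
    (r := 2 * (Fintype.card ι + 1 : ℕ)) (by
      rw [Module.finrank_fintype_fun_eq_card]
      push_cast
      have : (0 : ℝ) ≤ Fintype.card ι := Nat.cast_nonneg _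
      linarith)
  refine h.congr (Eventually.of_forall fun x => ?_)
  have : (-(2 * ((Fintype.card ι + 1 : ℕ) : ℝ)) / 2) = -((Fintype.card ι + 1 : ℕ) : ℝ) := by ring
  simp only [this]
  rw [Real.rpow_neg (by positivity), Real.rpow_natCast]

/-- Of the powers of `1 + |x|²` gained, `w.length` absorb the monomial and the other `card ι + 1`
leave an integrable function of `x`. -/
theorem norm_monomialFun_mul_oscIntegral_le [μ.IsAddHaarMeasure] {Y : E}
    (hY : ∀ x, x ⬝ᵥ Q Y *ᵥ x = x ⬝ᵥ x) (w : List ι) (φ : 𝓓((⊤ : Opens E), ℂ)) (x : ι → ℝ) :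
    ‖(monomialFun w x : ℂ) * oscIntegral Q μ φ x‖ ≤
      ((1 + ‖x‖ ^ 2) ^ (Fintype.card ι + 1))⁻¹ *
        ∫ X, ‖((1 + derivOp Y) ^ (w.length + (Fintype.card ι + 1))) φ X‖ ∂μ := by
  have h := norm_oscIntegral_le Q μ (((1 + derivOp Y) ^ (w.length + (Fintype.card ι + 1))) φ) x
  rw [oscIntegral_pow Q μ hY] at h
  have h1 := sq_norm_le_dotProduct x
  have h0 : 0 < 1 + ‖x‖ ^ 2 := by positivity
  have h2 : 0 < 1 + x ⬝ᵥ x := by linarith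
  have h3 : (1 + ‖x‖ ^ 2) ^ (Fintype.card ι + 1) ≤ (1 + x ⬝ᵥ x) ^ (Fintype.card ι + 1) :=
    pow_le_pow_left₀ h0.le (by linarith) _
  rw [inv_mul_eq_div, le_div_iff₀ (by positivity)]
  refine le_trans ?_ h
  rw [norm_mul, norm_mul, norm_pow, norm_real, norm_real, Real.norm_eq_abs, Real.norm_eq_abs,
    abs_of_pos h2, pow_add (1 + x ⬝ᵥ x)]
  calc |monomialFun w x| * ‖oscIntegral Q μ φ x‖ * (1 + ‖x‖ ^ 2) ^ (Fintype.card ι + 1)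
      ≤ (1 + x ⬝ᵥ x) ^ w.length * ‖oscIntegral Q μ φ x‖
        * (1 + x ⬝ᵥ x) ^ (Fintype.card ι + 1) := by
        gcongr
        exact abs_monomialFun_le w x
    _ = _ := by ring

theorem integrable_monomialFun_mul_oscIntegral [μ.IsAddHaarMeasure] {Y : E}
    (hY : ∀ x, x ⬝ᵥ Q Y *ᵥ x = x ⬝ᵥ x) (w : List ι) (φ : 𝓓((⊤ : Opens E), ℂ)) :
    Integrable fun x => (monomialFun w x : ℂ) * oscIntegral Q μ φ x := by
  refine (integrable_inv_one_add_norm_sq_pow.mul_const _).mono' ?_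
    (Eventually.of_forall fun x => norm_monomialFun_mul_oscIntegral_le Q μ hY w φ x)
  exact ((continuous_ofReal.comp (continuous_monomialFun w)).mul
    (continuous_oscIntegral Q μ φ)).aestronglyMeasurable

/-- The distribution `φ ↦ ∫ x^w (∫ φ(X) exp(-(i/2) x · Q(X) x) dμ(X)) dx`. -/
def momentDistribution [μ.IsAddHaarMeasure] {Y : E} (hY : ∀ x, x ⬝ᵥ Q Y *ᵥ x = x ⬝ᵥ x)
    (w : List ι) : 𝓓((⊤ : Opens E), ℂ) →L[ℂ] ℂ :=
  have hadd : ∀ φ ψ : 𝓓((⊤ : Opens E), ℂ),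
      ∫ x, (monomialFun w x : ℂ) * oscIntegral Q μ (φ + ψ : 𝓓((⊤ : Opens E), ℂ)) x
        = (∫ x, (monomialFun w x : ℂ) * oscIntegral Q μ φ x)
          + ∫ x, (monomialFun w x : ℂ) * oscIntegral Q μ ψ x := fun φ ψ => by
    rw [← integral_add (integrable_monomialFun_mul_oscIntegral Q μ hY w φ)
      (integrable_monomialFun_mul_oscIntegral Q μ hY w ψ)]
    simp only [oscIntegral_add, mul_add]
  TestFunction.mkCLM ℂ (fun φ => ∫ x, (monomialFun w x : ℂ) * oscIntegral Q μ φ x) hadd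
    (fun c φ => by
      rw [smul_eq_mul, ← integral_const_mul]
      simp only [oscIntegral_smul, mul_left_comm])
    (fun K hK => by
      -- Continuity on test functions supported in `K`: the integral is at most `A · μ(K)` times the
      -- sup norm of `L f`, and `L` is a continuous operator.
      let L := (1 + derivOp Y) ^ (w.length + (Fintype.card ι + 1))
      let T := (TestFunction.toBoundedContinuousFunctionCLM ℂ).comp
        (L.comp (TestFunction.ofSupportedInCLM ℂ (n := ⊤) (F := ℂ) hK))
      let Λ : 𝓓_{K}(E, ℂ) →+ ℂ := AddMonoidHom.mk' (fun f =>
        ∫ x, (monomialFun w x : ℂ) * oscIntegral Q μ (TestFunction.ofSupportedIn hK f) x)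
        (fun f g => hadd (TestFunction.ofSupportedIn hK f) (TestFunction.ofSupportedIn hK g))
      set A : ℝ := ∫ x : ι → ℝ, ((1 + ‖x‖ ^ 2) ^ (Fintype.card ι + 1))⁻¹
      have hA : 0 ≤ A := integral_nonneg fun x => by positivity
      have hbound : ∀ f, ‖Λ f‖ ≤ A * (‖T f‖ * μ.real K) := by
        intro f
        set φ := TestFunction.ofSupportedIn hK f
        have h1 : ‖Λ f‖ ≤ A * ∫ X, ‖L φ X‖ ∂μ := by
          rw [← integral_mul_const]
          exact norm_integral_le_of_norm_le (integrable_inv_one_add_norm_sq_pow.mul_const _)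
            (Eventually.of_forall fun x => norm_monomialFun_mul_oscIntegral_le Q μ hY w φ x)
        refine h1.trans (mul_le_mul_of_nonneg_left ?_ hA)
        have h2 : ∫ X, ‖L φ X‖ ∂μ = ∫ X in K, ‖L φ X‖ ∂μ := by
          refine (setIntegral_eq_integral_of_forall_compl_eq_zero fun X hX => ?_).symm
          rw [norm_eq_zero]
          refine image_eq_zero_of_notMem_tsupport fun h => hX ?_
          exact f.tsupport_subset (tsupport_pow_one_add_derivOp_subset _ _ _ h)
        rw [h2]
        have h3 := norm_setIntegral_le_of_norm_le_const (μ := μ) (s := (K : Set E))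
          (f := fun X => ‖L φ X‖) (C := ‖T f‖) K.isCompact.measure_lt_top
          (fun X _ => by rw [norm_norm]; exact (T f).norm_coe_le_norm X)
        exact (Real.le_norm_self _).trans h3
      change Continuous Λ
      refine continuous_of_continuousAt_zero Λ ?_
      rw [ContinuousAt, map_zero]
      refine squeeze_zero_norm hbound ?_
      have hc : Continuous fun f => A * (‖T f‖ * μ.real K) := by fun_prop
      simpa using hc.tendsto 0)

theorem momentDistribution_apply [μ.IsAddHaarMeasure] {Y : E} (hY : ∀ x, x ⬝ᵥ Q Y *ᵥ x = x ⬝ᵥ x)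
    (w : List ι) (φ : 𝓓((⊤ : Opens E), ℂ)) :
    momentDistribution Q μ hY w φ = ∫ x, (monomialFun w x : ℂ) * oscIntegral Q μ φ x := rfl

end OscIntegral

end SuperPfaffian
end

/-! ### Smooth densities at nondegenerate points. -/

noncomputable section

namespace SuperPfaffian

open Matrix Complex Filter Topology

theorem exists_symm_quadForm {ι : Type*} [Fintype ι] (i j : ι) :
    ∃ S : Matrix ι ι ℝ, S.IsSymm ∧ ∀ x, x ⬝ᵥ S *ᵥ x = x i * x j := by
  classical
  refine ⟨(1 / 2 : ℝ) • (Matrix.single i j 1 + Matrix.single j i 1), ?_, fun x => ?_⟩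
  · rw [Matrix.IsSymm, transpose_smul, transpose_add, transpose_single, transpose_single, add_comm]
  · have h : ∀ (k : ι) (a : ℝ), x ⬝ᵥ Function.update 0 k a = x k * a := fun k a =>
      dotProduct_single x a k
    simp only [smul_mulVec, add_mulVec, dotProduct_smul, dotProduct_add, single_mulVec, h,
      smul_eq_mul]
    ring

section Smoothness

variable {ι : Type*} [Fintype ι] {E : Type*} [NormedAddCommGroup E]
  [NormedSpace ℝ E] {Q : E →ₗ[ℝ] Matrix ι ι ℝ}
  [FiniteDimensional ℝ E] [MeasurableSpace E] [BorelSpace E] (μ : Measure E) [μ.IsAddHaarMeasure]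

/-- Fubini. The cutoff makes the double integral absolutely convergent; without it the two
integrations could not be exchanged. -/
theorem integral_gaussianCutoff_mul_oscIntegral {ε : ℝ} (hε : 0 < ε) (φ : 𝓓((⊤ : Opens E), ℂ)) :
    ∫ x, gaussianCutoff ε x * oscIntegral Q μ φ x = ∫ X, φ X * regGaussian ε (Q X) ∂μ := by
  have hφ : Integrable φ μ := φ.continuous.integrable_of_hasCompactSupport φ.hasCompactSupport
  have hint : Integrable (Function.uncurry fun (x : ι → ℝ) (X : E) =>
      gaussianCutoff ε x * φ X * phase (Q X) x) (volume.prod μ) := by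
    refine ((integrable_gaussianCutoff hε).mul_prod hφ).mul_bdd (c := 1) ?_ ?_
    · refine Continuous.aestronglyMeasurable ?_
      exact continuous_phase.comp
        ((Q.continuous_of_finiteDimensional.comp continuous_snd).prodMk continuous_fst)
    · exact Eventually.of_forall fun p => (norm_phase _ _).le
  have h := integral_integral_swap hint
  have e1 : ∀ x : ι → ℝ, ∫ X, gaussianCutoff ε x * φ X * phase (Q X) x ∂μ
      = gaussianCutoff ε x * oscIntegral Q μ φ x := fun x => by
    simp only [oscIntegral, ← integral_const_mul, mul_assoc]
  have e2 : ∀ X : E, ∫ x, gaussianCutoff ε x * φ X * phase (Q X) x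
      = φ X * regGaussian ε (Q X) := fun X => by
    rw [regGaussian, ← integral_const_mul]
    congr 1
    ext x
    ring
  simpa only [e1, e2] using h

/-- At points where `Q` is non degenerate, the oscillating Gaussian integral is a smooth function,
the square of which is `(2π)^m / det (i Q)`. -/
theorem exists_density_momentDistribution_nil [DecidableEq ι] (hQ : ∀ X, (Q X).IsSymm) {Y : E}
    (hY : ∀ x, x ⬝ᵥ Q Y *ᵥ x = x ⬝ᵥ x) {X₀ : E} (hX₀ : (Q X₀).det ≠ 0) :
    ∃ U : Set E, IsOpen U ∧ X₀ ∈ U ∧ ∃ G : E → ℂ, ContDiffOn ℝ ∞ G U ∧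
      (∀ X ∈ U, G X ^ 2 * (I ^ Fintype.card ι * ((Q X).det : ℂ)) = (2 * Real.pi) ^ Fintype.card ι) ∧
      ∀ φ : 𝓓((⊤ : Opens E), ℂ), tsupport φ ⊆ U →
        momentDistribution Q μ hY [] φ = ∫ X, φ X * G X ∂μ := by
  obtain ⟨U, hU, hXU, G, hG, hsq, ε, hε, hε0, ⟨C, hC⟩, hlim⟩ := exists_limit_regGaussian Q hQ hX₀
  refine ⟨U, hU, hXU, G, hG, hsq, fun φ hφ => ?_⟩
  have hφi : Integrable φ μ := φ.continuous.integrable_of_hasCompactSupport φ.hasCompactSupport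
  have hJ : Integrable (oscIntegral Q μ φ) := by
    simpa [monomialFun] using integrable_monomialFun_mul_oscIntegral Q μ hY [] φ
  -- The cutoff is removed on both sides of the Fubini identity by dominated convergence. The
  -- dominating functions are `‖oscIntegral Q μ φ‖` here and `C ‖φ‖` in `h2`, where the uniform
  -- bound on `U` is used.
  have h1 : Tendsto (fun k => ∫ x, gaussianCutoff (ε k) x * oscIntegral Q μ φ x) atTop
      (𝓝 (momentDistribution Q μ hY [] φ)) := by
    rw [momentDistribution_apply]
    refine tendsto_integral_of_dominated_convergence (fun x => ‖oscIntegral Q μ φ x‖) ?_ hJ.norm ?_ ?_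
    · exact fun k => ((continuous_gaussianCutoff _).mul
        (continuous_oscIntegral Q μ φ)).aestronglyMeasurable
    · refine fun k => Eventually.of_forall fun x => ?_
      rw [norm_mul]
      exact mul_le_of_le_one_left (norm_nonneg _) (norm_gaussianCutoff_le (hε k) x)
    · refine Eventually.of_forall fun x => ?_
      simp only [monomialFun, List.map_nil, List.prod_nil, ofReal_one]
      refine Tendsto.mul_const _ ?_
      have hc : Continuous fun e : ℝ => gaussianCutoff e x := by
        unfold gaussianCutoff
        fun_prop
      have := (hc.tendsto 0).comp hε0
      simpa [gaussianCutoff, Function.comp_def] using this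
  have h2 : Tendsto (fun k => ∫ X, φ X * regGaussian (ε k) (Q X) ∂μ) atTop
      (𝓝 (∫ X, φ X * G X ∂μ)) := by
    refine tendsto_integral_of_dominated_convergence (fun X => ‖φ X‖ * C) ?_
      (hφi.norm.mul_const C) ?_ ?_
    · exact fun k => (φ.continuous.mul ((continuous_regGaussian (hε k)).comp
        Q.continuous_of_finiteDimensional)).aestronglyMeasurable
    · refine fun k => Eventually.of_forall fun X => ?_
      rw [norm_mul]
      by_cases hX : X ∈ U
      · exact mul_le_mul_of_nonneg_left (hC k X hX) (norm_nonneg _)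
      · rw [image_eq_zero_of_notMem_tsupport fun h => hX (hφ h)]
        simp
    · refine Eventually.of_forall fun X => ?_
      by_cases hX : X ∈ U
      · exact (hlim X hX).const_mul _
      · rw [image_eq_zero_of_notMem_tsupport fun h => hX (hφ h)]
        simp
  simp only [integral_gaussianCutoff_mul_oscIntegral μ (hε _)] at h1
  exact tendsto_nhds_unique h1 h2

/-- The oscillating integral is even in `x`, so a single coordinate makes the integrand odd. -/
theorem momentDistribution_singleton {Y : E} (hY : ∀ x, x ⬝ᵥ Q Y *ᵥ x = x ⬝ᵥ x) (i : ι)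
    (φ : 𝓓((⊤ : Opens E), ℂ)) : momentDistribution Q μ hY [i] φ = 0 := by
  rw [momentDistribution_apply]
  have h := integral_neg_eq_self (fun x => (monomialFun [i] x : ℂ) * oscIntegral Q μ φ x) volume
  have e : ∀ x : ι → ℝ, (monomialFun [i] (-x) : ℂ) * oscIntegral Q μ φ (-x)
      = -((monomialFun [i] x : ℂ) * oscIntegral Q μ φ x) := fun x => by
    simp [monomialFun, oscIntegral_neg]
  simp only [e, integral_neg] at h
  exact self_eq_neg.1 h.symm

/-- Two coordinates are traded for one derivative of the test function. -/
theorem momentDistribution_cons_cons {Y : E} (hY : ∀ x, x ⬝ᵥ Q Y *ᵥ x = x ⬝ᵥ x) {i j : ι} {Z : E}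
    (hZ : ∀ x, x ⬝ᵥ Q Z *ᵥ x = x i * x j) (w : List ι) (φ : 𝓓((⊤ : Opens E), ℂ)) :
    momentDistribution Q μ hY (i :: j :: w) φ = momentDistribution Q μ hY w (derivOp Z φ) := by
  rw [momentDistribution_apply, momentDistribution_apply]
  congr 1
  ext x
  rw [oscIntegral_derivOp, hZ]
  simp only [monomialFun, List.map_cons, List.prod_cons]
  push_cast
  ring

/-- Coordinates are removed in pairs, each pair differentiating the density once more, until the
Gaussian density or zero remains. Differentiation does not shrink the domain, so one `U` serves all
`w`. -/
theorem exists_density_momentDistribution [DecidableEq ι] (hQ : ∀ X, (Q X).IsSymm)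
    (hspan : ∀ S : Matrix ι ι ℝ, S.IsSymm → ∃ Z, Q Z = S) {Y : E}
    (hY : ∀ x, x ⬝ᵥ Q Y *ᵥ x = x ⬝ᵥ x) {X₀ : E} (hX₀ : (Q X₀).det ≠ 0) :
    ∃ U : Set E, IsOpen U ∧ X₀ ∈ U ∧ ∀ w : List ι, ∃ F : E → ℂ, ContDiffOn ℝ ∞ F U ∧
      ∀ φ : 𝓓((⊤ : Opens E), ℂ), tsupport φ ⊆ U →
        momentDistribution Q μ hY w φ = ∫ X, φ X * F X ∂μ := by
  obtain ⟨U, hU, hXU, G, hG, -, hφ⟩ := exists_density_momentDistribution_nil μ hQ hY hX₀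
  refine ⟨U, hU, hXU, fun w => ?_⟩
  induction w using List.twoStepInduction with
  | nil => exact ⟨G, hG, hφ⟩
  | singleton i =>
    exact ⟨0, contDiffOn_const, fun φ _ => by simp [momentDistribution_singleton]⟩
  | cons_cons i j w ih _ =>
    obtain ⟨F, hF, hFφ⟩ := ih
    obtain ⟨S, hS, hSx⟩ := exists_symm_quadForm i j
    obtain ⟨Z, rfl⟩ := hspan S hS
    refine ⟨fun X => 2 * I * fderiv ℝ F X Z, ?_, fun φ hφU => ?_⟩
    · exact contDiffOn_const.mul ((hF.fderiv_of_isOpen hU (by simp)).clm_apply contDiffOn_const)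
    · rw [momentDistribution_cons_cons μ hY hSx, hFφ _ ((tsupport_derivOp_subset Z φ).trans hφU),
        integral_derivOp_mul μ Z hU hF hφU]

end Smoothness

/-! ### The algebra of polynomial amplitudes. -/

section Amplitudes

variable (ι : Type*) (E : Type*) [NormedAddCommGroup E] [NormedSpace ℝ E]
  (W : Type*) [AddCommGroup W] [Module ℂ W]

/-- The functions of `x` and `X` that are polynomial in `x` with coefficients that are smooth
in `X`. -/
def amplitudes : Submodule ℂ ((ι → ℝ) → E → W) :=
  Submodule.span ℂ {f | ∃ (w : List ι) (d : E → ℂ) (v : W), ContDiff ℝ ∞ d ∧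
    f = fun x X => ((monomialFun w x : ℂ) * d X) • v}

variable {ι E W}

theorem mem_amplitudes (w : List ι) {d : E → ℂ} (hd : ContDiff ℝ ∞ d) (v : W) :
    (fun (x : ι → ℝ) X => ((monomialFun w x : ℂ) * d X) • v) ∈ amplitudes ι E W :=
  Submodule.subset_span ⟨w, d, v, hd, rfl⟩

theorem const_mem_amplitudes (v : W) : (fun _ _ => v) ∈ amplitudes ι E W := by
  simpa [monomialFun] using mem_amplitudes (ι := ι) [] (contDiff_const (𝕜 := ℝ) (E := E) (c := (1 : ℂ))) v

theorem map_mem_amplitudes {W' : Type*} [AddCommGroup W'] [Module ℂ W'] (L : W →ₗ[ℂ] W')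
    {f : (ι → ℝ) → E → W} (hf : f ∈ amplitudes ι E W) :
    (fun x X => L (f x X)) ∈ amplitudes ι E W' := by
  induction hf using Submodule.span_induction with
  | mem f hf =>
    obtain ⟨w, d, v, hd, rfl⟩ := hf
    simpa only [map_smul] using mem_amplitudes w hd (L v)
  | zero => simp only [Pi.zero_apply, map_zero]; exact (amplitudes ι E W').zero_mem
  | add f g _ _ hf hg => simp only [Pi.add_apply, map_add]; exact (amplitudes ι E W').add_mem hf hg
  | smul c f _ hf => simp only [Pi.smul_apply, map_smul]; exact (amplitudes ι E W').smul_mem c hf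

theorem mul_mem_amplitudes {A : Type*} [Ring A] [Algebra ℂ A] {f g : (ι → ℝ) → E → A}
    (hf : f ∈ amplitudes ι E A) (hg : g ∈ amplitudes ι E A) : f * g ∈ amplitudes ι E A := by
  refine Submodule.span_induction₂ (p := fun f g _ _ => f * g ∈ amplitudes ι E A)
    ?_ ?_ ?_ ?_ ?_ ?_ ?_ hf hg
  · rintro _ _ ⟨w, d, v, hd, rfl⟩ ⟨w', d', v', hd', rfl⟩
    convert mem_amplitudes (w ++ w') (hd.mul hd') (v * v') using 1
    ext x X
    simp only [Pi.mul_apply, smul_mul_smul_comm, monomialFun, List.map_append, List.prod_append]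
    congr 1
    push_cast
    ring
  · intro _ _; rw [zero_mul]; exact Submodule.zero_mem _
  · intro _ _; rw [mul_zero]; exact Submodule.zero_mem _
  · intro f f' g _ _ _ h h'; rw [add_mul]; exact Submodule.add_mem _ h h'
  · intro f g g' _ _ _ h h'; rw [mul_add]; exact Submodule.add_mem _ h h'
  · intro c f g _ _ h; rw [smul_mul_assoc]; exact Submodule.smul_mem _ c h
  · intro c f g _ _ h; rw [mul_smul_comm]; exact Submodule.smul_mem _ c h

theorem pow_mem_amplitudes {A : Type*} [Ring A] [Algebra ℂ A] {f : (ι → ℝ) → E → A}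
    (hf : f ∈ amplitudes ι E A) (k : ℕ) : f ^ k ∈ amplitudes ι E A := by
  induction k with
  | zero => rw [pow_zero]; exact const_mem_amplitudes 1
  | succ k ih => rw [pow_succ]; exact mul_mem_amplitudes ih hf

end Amplitudes

end SuperPfaffian
end

/-! ### Oscillating integrals with amplitude, and their singularities. -/

noncomputable section

namespace SuperPfaffian

open Matrix Complex Filter Topology

section SingularSupport

variable {ι : Type*} [Fintype ι] [DecidableEq ι] {E : Type*} [NormedAddCommGroup E]
  [NormedSpace ℝ E] {Q : E →ₗ[ℝ] Matrix ι ι ℝ}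
  [FiniteDimensional ℝ E] [MeasurableSpace E] [BorelSpace E] (μ : Measure E) [μ.IsAddHaarMeasure]

/-- Amplitudes define oscillating integrals that converge as generalized functions, which are
smooth at the points where `Q` is non degenerate. -/
theorem exists_distribution_of_mem_amplitudes (hQ : ∀ X, (Q X).IsSymm)
    (hspan : ∀ S : Matrix ι ι ℝ, S.IsSymm → ∃ Z, Q Z = S)
    {f : (ι → ℝ) → E → ℂ} (hf : f ∈ amplitudes ι E ℂ) :
    (∀ x, Continuous (f x)) ∧ ∃ T : 𝓓((⊤ : Opens E), ℂ) →L[ℂ] ℂ,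
      (∀ φ : 𝓓((⊤ : Opens E), ℂ),
        Integrable (fun x => ∫ X, φ X * (phase (Q X) x * f x X) ∂μ) ∧
        T φ = ∫ x, ∫ X, φ X * (phase (Q X) x * f x X) ∂μ) ∧
      ∀ X₀, (Q X₀).det ≠ 0 → ∃ U : Set E, IsOpen U ∧ X₀ ∈ U ∧ ∃ F : E → ℂ, ContDiffOn ℝ ∞ F U ∧
        ∀ φ : 𝓓((⊤ : Opens E), ℂ), tsupport φ ⊆ U → T φ = ∫ X, φ X * F X ∂μ := by
  -- Continuity of `f x` is carried through the induction because the sum case needs it to split the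
  -- inner integral.
  have hint : ∀ {f : (ι → ℝ) → E → ℂ}, (∀ x, Continuous (f x)) → ∀ (φ : 𝓓((⊤ : Opens E), ℂ)) x,
      Integrable (fun X => φ X * (phase (Q X) x * f x X)) μ := fun hf φ x =>
    TestFunction_mul_integrable μ isOpen_univ
      ((contDiff_phase Q x).continuous.mul (hf x)).continuousOn (Set.subset_univ _)
  induction hf using Submodule.span_induction with
  | mem f hf =>
    obtain ⟨w, d, v, hd, rfl⟩ := hf
    obtain ⟨Y, hY⟩ := hspan 1 Matrix.isSymm_one
    have hY' : ∀ x, x ⬝ᵥ Q Y *ᵥ x = x ⬝ᵥ x := fun x => by rw [hY, one_mulVec]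
    have he : ∀ (φ : 𝓓((⊤ : Opens E), ℂ)) (x : ι → ℝ),
        ∫ X, φ X * (phase (Q X) x * (((monomialFun w x : ℂ) * d X) • v)) ∂μ
          = v * ((monomialFun w x : ℂ) * oscIntegral Q μ (mulSmooth hd φ) x) := fun φ x => by
      rw [oscIntegral, ← integral_const_mul, ← integral_const_mul]
      congr 1
      ext X
      rw [mulSmooth_apply, smul_eq_mul]
      ring
    refine ⟨fun x => (continuous_const.mul hd.continuous).smul continuous_const,
      -- The smooth coefficient `d` is absorbed into the test function; dually, it multiplies the
      -- density.
      v • (momentDistribution Q μ hY' w).comp (mulSmooth hd), fun φ => ⟨?_, ?_⟩, fun X₀ hX₀ => ?_⟩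
    · simp only [he]
      exact (integrable_monomialFun_mul_oscIntegral Q μ hY' w _).const_mul v
    · simp only [he, integral_const_mul]
      rfl
    · obtain ⟨U, hU, hXU, h⟩ := exists_density_momentDistribution μ hQ hspan hY' hX₀
      obtain ⟨F, hF, hφ⟩ := h w
      refine ⟨U, hU, hXU, fun X => v * (d X * F X),
        contDiffOn_const.mul (hd.contDiffOn.mul hF), fun φ hφU => ?_⟩
      have h1 : tsupport (mulSmooth hd φ) ⊆ U := by
        refine Set.Subset.trans ?_ hφU
        exact tsupport_mul_subset_left (f := φ) (g := d)
      change v * momentDistribution Q μ hY' w (mulSmooth hd φ) = _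
      rw [hφ _ h1, ← integral_const_mul]
      congr 1
      ext X
      rw [mulSmooth_apply]
      ring
  | zero =>
    refine ⟨fun x => continuous_const, 0, fun φ => by simp, fun X₀ _ =>
      ⟨Set.univ, isOpen_univ, Set.mem_univ _, 0, contDiffOn_const, fun φ _ => by simp⟩⟩
  | add f g _ _ hf hg =>
    obtain ⟨hfc, T, hT, hTF⟩ := hf
    obtain ⟨hgc, S, hS, hSG⟩ := hg
    have he : ∀ (φ : 𝓓((⊤ : Opens E), ℂ)) (x : ι → ℝ),
        ∫ X, φ X * (phase (Q X) x * (f + g) x X) ∂μ = (∫ X, φ X * (phase (Q X) x * f x X) ∂μ)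
          + ∫ X, φ X * (phase (Q X) x * g x X) ∂μ := fun φ x => by
      rw [← integral_add (hint hfc φ x) (hint hgc φ x)]
      simp only [Pi.add_apply, mul_add]
    refine ⟨fun x => (hfc x).add (hgc x), T + S, fun φ => ⟨?_, ?_⟩, fun X₀ hX₀ => ?_⟩
    · simp only [he]
      exact (hT φ).1.add (hS φ).1
    · simp only [he]
      rw [integral_add (hT φ).1 (hS φ).1, ← (hT φ).2, ← (hS φ).2]
      rfl
    · obtain ⟨U, hU, hXU, F, hF, h⟩ := hTF X₀ hX₀
      obtain ⟨U', hU', hXU', G, hG, h'⟩ := hSG X₀ hX₀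
      refine ⟨U ∩ U', hU.inter hU', ⟨hXU, hXU'⟩, F + G,
        (hF.mono Set.inter_subset_left).add (hG.mono Set.inter_subset_right), fun φ hφ => ?_⟩
      have h1 := hφ.trans Set.inter_subset_left
      have h2 := hφ.trans Set.inter_subset_right
      change T φ + S φ = _
      rw [h φ h1, h' φ h2, ← integral_add (TestFunction_mul_integrable μ hU hF.continuousOn h1)
        (TestFunction_mul_integrable μ hU' hG.continuousOn h2)]
      simp only [Pi.add_apply, mul_add]
  | smul c f _ hf =>
    obtain ⟨hfc, T, hT, hTF⟩ := hf
    have he : ∀ (φ : 𝓓((⊤ : Opens E), ℂ)) (x : ι → ℝ),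
        ∫ X, φ X * (phase (Q X) x * (c • f) x X) ∂μ
          = c * ∫ X, φ X * (phase (Q X) x * f x X) ∂μ := fun φ x => by
      rw [← integral_const_mul]
      simp only [Pi.smul_apply, smul_eq_mul, mul_left_comm]
    refine ⟨fun x => (hfc x).const_smul c, c • T, fun φ => ⟨?_, ?_⟩, fun X₀ hX₀ => ?_⟩
    · simp only [he]
      exact (hT φ).1.const_mul c
    · simp only [he]
      rw [integral_const_mul, ← (hT φ).2]
      rfl
    · obtain ⟨U, hU, hXU, F, hF, h⟩ := hTF X₀ hX₀
      refine ⟨U, hU, hXU, fun X => c * F X, contDiffOn_const.mul hF, fun φ hφ => ?_⟩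
      change c * T φ = _
      rw [h φ hφ, ← integral_const_mul]
      simp only [mul_left_comm]

/-- The exceptional `t` are roots of the characteristic polynomial of `-M`, hence finite in number.
Degenerate points are thus limits of nondegenerate ones along a direction `Y` with `Q Y = 1`. -/
theorem eventually_det_add_smul_one_ne_zero (M : Matrix ι ι ℝ) :
    ∀ᶠ t : ℝ in 𝓝[≠] 0, (M + t • (1 : Matrix ι ι ℝ)).det ≠ 0 := by
  have hfin : {t : ℝ | (-M).charpoly.IsRoot t}.Finite :=
    Polynomial.finite_setOfPred_isRoot (charpoly_monic (-M)).ne_zero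
  have h : ∀ t : ℝ, (-M).charpoly.IsRoot t ↔ (M + t • (1 : Matrix ι ι ℝ)).det = 0 := fun t => by
    rw [Polynomial.IsRoot, Matrix.eval_charpoly, sub_neg_eq_add, add_comm, smul_one_eq_diagonal]
    rfl
  have h2 : ({t : ℝ | (-M).charpoly.IsRoot t} \ {0})ᶜ ∈ 𝓝 (0 : ℝ) :=
    (hfin.subset Set.sdiff_subset).isClosed.isOpen_compl.mem_nhds (by simp)
  filter_upwards [nhdsWithin_le_nhds h2, self_mem_nhdsWithin] with t ht ht0 hdet
  exact ht ⟨(h t).2 hdet, ht0⟩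

/-- If the oscillating integral of amplitude `p(X)` is a continuous function near a point where
`Q` is degenerate, then `p` vanishes there. -/
theorem amplitude_eq_zero_of_continuousOn (hQ : ∀ X, (Q X).IsSymm)
    (hspan : ∀ S : Matrix ι ι ℝ, S.IsSymm → ∃ Z, Q Z = S) {p : E → ℂ} (hp : ContDiff ℝ ∞ p)
    {c : ℂ} (hc : c ≠ 0) {U : Set E} (hU : IsOpen U) {F : E → ℂ} (hF : ContinuousOn F U)
    (h : ∀ ρ : 𝓓((⊤ : Opens E), ℝ), tsupport ρ ⊆ U →
      c * ∫ x, ∫ X, (ρ X : ℂ) * (phase (Q X) x * p X) ∂μ = ∫ X, (ρ X : ℂ) * F X ∂μ)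
    {X₀ : E} (hX₀ : X₀ ∈ U) (hdet : (Q X₀).det = 0) : p X₀ = 0 := by
  obtain ⟨Y, hY⟩ := hspan 1 Matrix.isSymm_one
  have hY' : ∀ x, x ⬝ᵥ Q Y *ᵥ x = x ⬝ᵥ x := fun x => by rw [hY, one_mulVec]
  -- Locally `F = c p G`, with `G` known only through its square. The squared relation no longer
  -- involves `G` and makes sense at degenerate points as well.
  have hreg : ∀ X ∈ U, (Q X).det ≠ 0 → F X ^ 2 * (I ^ Fintype.card ι * ((Q X).det : ℂ))
      - (c * p X) ^ 2 * (2 * Real.pi) ^ Fintype.card ι = 0 := by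
    intro X hX hXdet
    obtain ⟨U', hU', hXU', G, hG, hsq, hφ⟩ :=
      exists_density_momentDistribution_nil μ hQ hY' hXdet
    have hV := hU.inter hU'
    have hcG : ContinuousOn (fun X => c * (p X * G X)) (U ∩ U') :=
      continuousOn_const.mul (hp.continuous.continuousOn.mul
        (hG.continuousOn.mono Set.inter_subset_right))
    have hFc := hF.mono (Set.inter_subset_left (t := U'))
    -- Both densities represent the same distribution, so they agree almost everywhere, and then
    -- everywhere on the open set by continuity.
    have hae := hV.ae_eq_zero_of_integral_contDiff_smul_eq_zero (μ := μ)
      (f := fun X => F X - c * (p X * G X))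
      ((hFc.sub hcG).locallyIntegrableOn hV.measurableSet) (fun g hg hgc hgs => by
        let ρ : 𝓓((⊤ : Opens E), ℝ) := ⟨g, hg, hgc, by simp⟩
        let φ : 𝓓((⊤ : Opens E), ℂ) :=
          ⟨fun X => (g X : ℂ), ofRealCLM.contDiff.comp hg, hgc.comp_left ofReal_zero, by simp⟩
        have hφs : tsupport φ ⊆ U ∩ U' :=
          (closure_mono (show Function.support φ ⊆ Function.support g from fun X hX hg0 => hX (by
            change ((g X : ℝ) : ℂ) = 0
            rw [hg0, ofReal_zero]))).trans hgs
        have h1 := h ρ (hgs.trans Set.inter_subset_left)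
        have h2 : tsupport (mulSmooth hp φ) ⊆ U' :=
          (tsupport_mul_subset_left (f := φ) (g := p)).trans (hφs.trans Set.inter_subset_right)
        have h3 := hφ (mulSmooth hp φ) h2
        rw [momentDistribution_apply] at h3
        have e1 : ∀ x : ι → ℝ, (monomialFun [] x : ℂ) * oscIntegral Q μ (mulSmooth hp φ) x
            = ∫ X, (ρ X : ℂ) * (phase (Q X) x * p X) ∂μ := fun x => by
          simp only [monomialFun, List.map_nil, List.prod_nil, ofReal_one, one_mul, oscIntegral]
          congr 1
          ext X
          rw [mulSmooth_apply, mul_assoc, mul_comm (p X)]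
          rfl
        simp only [e1] at h3
        rw [h3] at h1
        have i1 : Integrable (fun X => (g X : ℂ) * F X) μ :=
          TestFunction_mul_integrable (φ := φ) μ hV hFc hφs
        have i2 : Integrable (fun X => (g X : ℂ) * (c * (p X * G X))) μ :=
          TestFunction_mul_integrable (φ := φ) μ hV hcG hφs
        simp only [real_smul, mul_sub]
        rw [integral_sub i1 i2, sub_eq_zero]
        refine h1.symm.trans ?_
        rw [← integral_const_mul]
        congr 1
        ext X
        rw [mulSmooth_apply]
        change c * ((g X : ℂ) * p X * G X) = _
        ring)
    have heq := Measure.eqOn_open_of_ae_eq (μ := μ) (f := F) (g := fun X => c * (p X * G X))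
      ((ae_restrict_iff' hV.measurableSet).2 (hae.mono fun X hX hXV => sub_eq_zero.1 (hX hXV)))
      hV hFc hcG ⟨hX, hXU'⟩
    have hs := hsq X hXU'
    simp only at heq
    rw [heq]
    linear_combination (c * p X) ^ 2 * hs
  have hline : Continuous fun t : ℝ => X₀ + t • Y := by fun_prop
  have hline0 : X₀ + (0 : ℝ) • Y = X₀ := by simp
  have hdetc : Continuous fun X => ((Q X).det : ℂ) :=
    continuous_ofReal.comp (Continuous.matrix_det Q.continuous_of_finiteDimensional)
  have hFX : ContinuousAt F X₀ := hF.continuousAt (hU.mem_nhds hX₀)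
  set H : E → ℂ := fun X => F X ^ 2 * (I ^ Fintype.card ι * ((Q X).det : ℂ))
      - (c * p X) ^ 2 * (2 * Real.pi) ^ Fintype.card ι with hH
  have hHc : ContinuousAt H X₀ :=
    ((hFX.pow 2).mul (continuous_const.mul hdetc).continuousAt).sub
      (((continuous_const.mul hp.continuous).pow 2).mul continuous_const).continuousAt
  have hlim : Tendsto (fun t : ℝ => H (X₀ + t • Y)) (𝓝[≠] 0) (𝓝 (H X₀)) := by
    have h1 : Tendsto (fun t : ℝ => X₀ + t • Y) (𝓝[≠] 0) (𝓝 X₀) := by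
      have := hline.tendsto 0
      rw [hline0] at this
      exact this.mono_left nhdsWithin_le_nhds
    exact hHc.tendsto.comp h1
  have hzero : ∀ᶠ t : ℝ in 𝓝[≠] 0, H (X₀ + t • Y) = 0 := by
    have h1 : ∀ᶠ t : ℝ in 𝓝[≠] 0, X₀ + t • Y ∈ U :=
      nhdsWithin_le_nhds (hline.continuousAt.preimage_mem_nhds
        (by rw [hline0]; exact hU.mem_nhds hX₀))
    filter_upwards [h1, eventually_det_add_smul_one_ne_zero (Q X₀)] with t ht htdet
    exact hreg _ ht (by rwa [map_add, map_smul, hY])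
  have hH0 : H X₀ = 0 :=
    tendsto_nhds_unique (hlim.congr' hzero) tendsto_const_nhds
  -- At `X₀` the determinant kills the term in `F²`, leaving `(c p)² (2π)^m = 0`.
  simp only [hH, hdet, ofReal_zero, mul_zero, zero_sub, neg_eq_zero] at hH0
  have := (mul_eq_zero.1 hH0).resolve_right (two_pi_pow_ne_zero _)
  exact (mul_eq_zero.1 (pow_eq_zero_iff two_ne_zero |>.1 this)).resolve_left hc

end SingularSupport

end SuperPfaffian
end

/-! ### Nilpotent exponentials and contractions in exterior algebras. -/

noncomputable section

namespace SuperPfaffian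

section NilpotentExp

variable {A : Type*} [Ring A]

/-- Pigeonhole: a product of `card + 1` commuting factors repeats one of them. The exponent depends
only on the number of terms. -/
theorem sum_pow_card_succ_eq_zero {κ : Type*} {a : κ → A} (hc : ∀ i j, Commute (a i) (a j))
    (h2 : ∀ i, a i ^ 2 = 0) (s : Finset κ) : (∑ i ∈ s, a i) ^ (s.card + 1) = 0 := by
  classical
  induction s using Finset.induction_on with
  | empty => simp
  | insert i s hi ih =>
    rw [Finset.sum_insert hi, Finset.card_insert_of_notMem hi]
    exact Commute.add_pow_eq_zero_of_add_le_succ_of_pow_eq_zero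
      (Commute.sum_right _ _ _ fun j _ => hc i j) (h2 i) ih (by omega)

variable [Module ℚ A]

theorem exp_eq_one_add {a : A} (h : a ^ 2 = 0) : IsNilpotent.exp a = 1 + a := by
  rw [IsNilpotent.exp_eq_sum h]
  simp [Finset.sum_range_succ]

theorem exp_sum_range {a : ℕ → A} (hc : ∀ i j, Commute (a i) (a j)) (h2 : ∀ i, a i ^ 2 = 0)
    (h : ℕ) : IsNilpotent.exp (∑ i ∈ Finset.range h, a i)
      = ((List.range h).map fun i => 1 + a i).prod := by
  induction h with
  | zero => simp
  | succ h ih =>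
    rw [Finset.sum_range_succ, IsNilpotent.exp_add_of_commute
      (Commute.sum_left _ _ _ fun i _ => hc i h) ⟨_, sum_pow_card_succ_eq_zero hc h2 _⟩
      ⟨2, h2 h⟩, ih, exp_eq_one_add (h2 h), List.range_succ, List.map_append, List.prod_append]
    simp

theorem add_smul_pow {A : Type*} [Ring A] [Algebra ℂ A] {x y : A} (h : Commute x y) (t : ℂ) (k : ℕ) :
    (x + t • y) ^ k = ∑ m ∈ Finset.range (k + 1),
      ((k.choose m : ℂ) * t ^ (k - m)) • (x ^ m * y ^ (k - m)) := by
  rw [(h.smul_right t).add_pow]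
  refine Finset.sum_congr rfl fun m _ => ?_
  rw [← nsmul_eq_mul', smul_pow, mul_smul_comm, ← Nat.cast_smul_eq_nsmul ℂ, smul_smul]

end NilpotentExp

section Exterior

variable {M : Type*} [AddCommGroup M] [Module ℂ M]

open ExteriorAlgebra

theorem ι_mul_ι_swap (a b : M) : ι ℂ a * ι ℂ b = -(ι ℂ b * ι ℂ a) :=
  eq_neg_of_add_eq_zero_left (ι_add_mul_swap a b)

theorem commute_ι_mul_ι_ι (a b c : M) : Commute (ι ℂ a * ι ℂ b) (ι ℂ c) := by
  rw [commute_iff_eq, mul_assoc, ι_mul_ι_swap b c, mul_neg, ← mul_assoc, ι_mul_ι_swap a c,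
    neg_mul, neg_neg, mul_assoc]

theorem commute_ι_mul_ι (a b c d : M) : Commute (ι ℂ a * ι ℂ b) (ι ℂ c * ι ℂ d) :=
  (commute_ι_mul_ι_ι a b c).mul_right (commute_ι_mul_ι_ι a b d)

theorem smul_ι_zero_mul (c : ℂ) (x : ExteriorAlgebra ℂ M) : c • (ι ℂ (0 : M) * x) = 0 := by
  rw [map_zero, zero_mul, smul_zero]

theorem ι_mul_ι_sq (a b : M) : (ι ℂ a * ι ℂ b) ^ 2 = 0 := by
  rw [sq, mul_assoc, ← mul_assoc (ι ℂ b), ι_mul_ι_swap b a, neg_mul, mul_assoc (ι ℂ a) (ι ℂ b),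
    ι_sq_zero, mul_zero, neg_zero, mul_zero]

theorem contractLeft_ι_mul_ι_mul {d : Module.Dual ℂ M} {a b : M} (ha : d a = 0) (hb : d b = 0)
    (x : ExteriorAlgebra ℂ M) :
    CliffordAlgebra.contractLeft d (ι ℂ a * ι ℂ b * x)
      = ι ℂ a * ι ℂ b * CliffordAlgebra.contractLeft d x := by
  rw [mul_assoc]
  erw [CliffordAlgebra.contractLeft_ι_mul, CliffordAlgebra.contractLeft_ι_mul]
  rw [ha, hb, zero_smul, zero_smul, zero_sub, zero_sub, mul_neg, neg_neg, mul_assoc]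

theorem contractLeft_prod_mul {d : Module.Dual ℂ M} {v : ℕ → M} {c : ℕ → ℂ} (h : ℕ)
    (hd : ∀ i < 2 * h, d (v i) = 0) (x : ExteriorAlgebra ℂ M) :
    CliffordAlgebra.contractLeft d
        (((List.range h).map fun k => 1 + c k • (ι ℂ (v (2 * k)) * ι ℂ (v (2 * k + 1)))).prod * x)
      = ((List.range h).map fun k => 1 + c k • (ι ℂ (v (2 * k)) * ι ℂ (v (2 * k + 1)))).prod *
        CliffordAlgebra.contractLeft d x := by
  induction h generalizing x with
  | zero => simp
  | succ h ih =>
    rw [List.range_succ, List.map_append, List.prod_append, mul_assoc,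
      ih (fun i hi => hd i (by omega)), mul_assoc]
    congr 1
    rw [List.map_singleton, List.prod_singleton, add_mul, one_mul, map_add, add_mul, one_mul,
      smul_mul_assoc, smul_mul_assoc, map_smul,
      contractLeft_ι_mul_ι_mul (hd _ (by omega)) (hd _ (by omega))]

/-- The Berezin integral of a product of factors `1 + c ξ^{2k} ξ^{2k+1}`. -/
theorem prod_contractLeft_prod {d : ℕ → Module.Dual ℂ M} {v : ℕ → M} (c : ℕ → ℂ) (h : ℕ)
    (hd : ∀ i < 2 * h, ∀ j < 2 * h, d i (v j) = if i = j then 1 else 0) :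
    (((List.range (2 * h)).map fun i =>
        (CliffordAlgebra.contractLeft (d i) : Module.End ℂ (ExteriorAlgebra ℂ M))).prod)
      (((List.range h).map fun k => 1 + c k • (ι ℂ (v (2 * k)) * ι ℂ (v (2 * k + 1)))).prod)
      = ((List.range h).map fun k => -c k).prod • 1 := by
  induction h with
  | zero => simp
  | succ h ih =>
    -- In a product of operators the last acts first: `∂/∂ξ^{2h+1}` and then `∂/∂ξ^{2h}` hit the
    -- last factor, while the earlier factors, free of these two variables, pass through. Moving
    -- past `ξ^{2h}` produces the sign in `-c h`.
    have hlist : List.range (2 * (h + 1)) = List.range (2 * h) ++ [2 * h, 2 * h + 1] := by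
      rw [Nat.mul_succ, List.range_succ, List.range_succ, List.append_assoc]
      rfl
    rw [hlist, List.map_append, List.prod_append, Module.End.mul_apply, List.map_cons,
      List.map_singleton, List.prod_cons, List.prod_singleton, Module.End.mul_apply]
    have hlast : ∀ i < 2 * (h + 1), 2 * h ≤ i → ∀ j < 2 * h, d i (v j) = 0 := fun i hi hi' j hj => by
      rw [hd i hi j (by omega), if_neg (by omega)]
    have e1 : ∀ i < 2 * (h + 1), d i (v (2 * h)) = if i = 2 * h then 1 else 0 :=
      fun i hi => hd i hi _ (by omega)
    have e2 : ∀ i < 2 * (h + 1), d i (v (2 * h + 1)) = if i = 2 * h + 1 then 1 else 0 :=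
      fun i hi => hd i hi _ (by omega)
    have s1 : CliffordAlgebra.contractLeft (d (2 * h + 1))
        (1 + c h • (ι ℂ (v (2 * h)) * ι ℂ (v (2 * h + 1))))
        = (-c h) • ι ℂ (v (2 * h)) := by
      rw [map_add, map_smul]
      erw [CliffordAlgebra.contractLeft_one, CliffordAlgebra.contractLeft_ι_mul,
        CliffordAlgebra.contractLeft_ι]
      rw [e1 _ (by omega), e2 _ (by omega), if_neg (by omega), if_pos rfl, zero_smul, map_one,
        mul_one, zero_sub, zero_add, smul_neg, neg_smul]
    have s2 : CliffordAlgebra.contractLeft (d (2 * h)) ((-c h) • ι ℂ (v (2 * h)))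
        = (-c h) • (1 : ExteriorAlgebra ℂ M) := by
      rw [map_smul]
      erw [CliffordAlgebra.contractLeft_ι]
      rw [e1 _ (by omega), if_pos rfl, map_one]
    rw [List.range_succ, List.map_append, List.prod_append, List.map_singleton, List.prod_singleton,
      contractLeft_prod_mul h (hlast _ (by omega) (by omega)), s1,
      contractLeft_prod_mul h (hlast _ (by omega) (by omega)), s2, mul_smul_comm, mul_one, map_smul,
      ih fun i hi j hj => hd i (by omega) j (by omega), List.map_append, List.prod_append,
      List.map_singleton, List.prod_singleton, smul_smul, mul_comm]

theorem exp_sum_smul_ι_mul_ι [Module ℚ (ExteriorAlgebra ℂ M)] (v : ℕ → M) (c : ℕ → ℂ) (h : ℕ) :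
    IsNilpotent.exp (∑ k ∈ Finset.range h, c k • (ι ℂ (v (2 * k)) * ι ℂ (v (2 * k + 1))))
      = ((List.range h).map fun k => 1 + c k • (ι ℂ (v (2 * k)) * ι ℂ (v (2 * k + 1)))).prod := by
  refine exp_sum_range (fun i j => ?_) (fun i => ?_) h
  · exact ((commute_ι_mul_ι _ _ _ _).smul_left _).smul_right _
  · rw [smul_pow, ι_mul_ι_sq, smul_zero]

theorem contractLeft_map {d : Module.Dual ℂ M} {g : M →ₗ[ℂ] M} (hd : ∀ m, d (g m) = d m)
    (x : ExteriorAlgebra ℂ M) :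
    CliffordAlgebra.contractLeft d (ExteriorAlgebra.map g x)
      = ExteriorAlgebra.map g (CliffordAlgebra.contractLeft d x) := by
  induction x using CliffordAlgebra.left_induction with
  | algebraMap c =>
    erw [AlgHom.commutes, CliffordAlgebra.contractLeft_algebraMap]
    rw [map_zero]
  | add x y hx hy => simp only [map_add, hx, hy]
  | ι_mul x m hx =>
    have e : ∀ y, ExteriorAlgebra.map g (CliffordAlgebra.ι 0 m * y)
        = CliffordAlgebra.ι 0 (g m) * ExteriorAlgebra.map g y := fun y => by
      rw [map_mul]
      congr 1
      exact ExteriorAlgebra.map_apply_ι g m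
    rw [e]
    erw [CliffordAlgebra.contractLeft_ι_mul, CliffordAlgebra.contractLeft_ι_mul, map_sub, map_smul,
      e, hx, hd]

end Exterior

end SuperPfaffian
end

/-! ### The amplitude of the superPfaffian. -/

noncomputable section

namespace SuperPfaffian

section Amplitude

variable {V₀ V₁ : Type*} [NormedAddCommGroup V₀] [NormedSpace ℝ V₀]
  [NormedAddCommGroup V₁] [NormedSpace ℝ V₁]
  {B₀ : LinearMap.BilinForm ℝ V₀} {B₁ : LinearMap.BilinForm ℝ V₁}
  {r n : ℕ} (b : OrientedSymplecticBasis B₀ B₁ r n)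

/-- The part `∑ᵢⱼ B(f_i, D f_j) ξ^j ξ^i` of the moment that only involves the odd coordinates. -/
def oddMoment : skewEnd B₁ →ₗ[ℝ] TotalAlgebra B₀ B₁ where
  toFun D := ∑ i, ∑ j,
    (b.coeff i * b.coeff j * (B₁ (b.odd i) (D.1 (b.odd j)) : ℂ)) • (xi b j * xi b i)
  map_add' D D' := by
    simp [mul_add, add_smul, Finset.sum_add_distrib]
  map_smul' t D := by
    simp only [Finset.smul_sum, RingHom.id_apply]
    refine Finset.sum_congr rfl fun i _ => Finset.sum_congr rfl fun j _ => ?_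
    rw [← Complex.coe_smul, smul_smul]
    congr 1
    simp
    ring

/-- The soul is a sum of `n² + 2n` products of two odd elements, which commute and square to zero.
The exponent is uniform in `u` and `X`. -/
theorem momentSoul_pow_eq_zero (u : V₀) (X : spoEven B₀ B₁) :
    momentSoul b u X ^ (Fintype.card ((Fin n × Fin n) ⊕ Fin n ⊕ Fin n) + 1) = 0 := by
  let a : (Fin n × Fin n) ⊕ Fin n ⊕ Fin n → TotalAlgebra B₀ B₁ :=
    Sum.elim (fun p => (b.coeff p.1 * b.coeff p.2 * (B₁ (b.odd p.1) (X.2.1 (b.odd p.2)) : ℂ)) •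
        (xi b p.2 * xi b p.1))
      (Sum.elim (fun j => xi b j * formEvenOdd b u j) (fun j => formOddEven b u j * xi b j))
  have hform : ∀ k, ∃ v w, a k = ExteriorAlgebra.ι ℂ v * ExteriorAlgebra.ι ℂ w := by
    rintro (p | j | j)
    · exact ⟨_, _, by
        simp only [a, Sum.elim_inl, xi]
        rw [← smul_mul_assoc, ← map_smul]⟩
    · exact ⟨_, _, rfl⟩
    · exact ⟨_, _, rfl⟩
  have hsum : momentSoul b u X = ∑ k, a k := by
    simp only [a, Fintype.sum_sum_type, Fintype.sum_prod_type, Sum.elim_inl, Sum.elim_inr,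
      momentSoul, add_assoc]
  rw [hsum]
  refine sum_pow_card_succ_eq_zero (fun i j => ?_) (fun i => ?_) _
  · obtain ⟨v, w, h⟩ := hform i
    obtain ⟨v', w', h'⟩ := hform j
    rw [h, h']
    exact commute_ι_mul_ι _ _ _ _
  · obtain ⟨v, w, h⟩ := hform i
    rw [h]
    exact ι_mul_ι_sq _ _

/-- The number of terms of the exponential series of the nilpotent part of the moment. -/
def expOrder (n : ℕ) : ℕ := Fintype.card ((Fin n × Fin n) ⊕ Fin n ⊕ Fin n) + 1

theorem exp_smul_eq_sum_range {a : TotalAlgebra B₀ B₁} {N : ℕ} (ha : a ^ N = 0) (c : ℂ) :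
    IsNilpotent.exp (c • a) = ∑ k ∈ Finset.range N, ((k.factorial : ℂ)⁻¹ * c ^ k) • a ^ k := by
  rw [IsNilpotent.exp_eq_sum (k := N) (by rw [smul_pow, ha, smul_zero])]
  refine Finset.sum_congr rfl fun k _ => ?_
  rw [← Rat.cast_smul_eq_qsmul ℂ, smul_pow, smul_smul]
  push_cast
  rfl

theorem formEvenOdd_equivFun (x : Fin r ⊕ Fin r → ℝ) (j : Fin n) :
    formEvenOdd b (b.even.equivFun.symm x) j
      = ∑ i, (x i : ℂ) • formEvenOdd b (b.even i) j := by
  simp only [formEvenOdd, ← map_smul, ← map_sum]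
  congr 1
  ext1
  · ext Y
    simp [Module.Basis.equivFun_symm_apply, Finset.mul_sum, Prod.fst_sum, mul_left_comm,
      -Fintype.sum_sum_type]
  · simp [Prod.snd_sum]

theorem formOddEven_equivFun (x : Fin r ⊕ Fin r → ℝ) (j : Fin n) :
    formOddEven b (b.even.equivFun.symm x) j
      = ∑ i, (x i : ℂ) • formOddEven b (b.even i) j := by
  simp only [formOddEven, ← map_smul, ← map_sum]
  congr 1
  ext1
  · ext Y
    simp [Module.Basis.equivFun_symm_apply, Finset.mul_sum, Prod.fst_sum, mul_left_comm,
      -Fintype.sum_sum_type]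
  · simp [Prod.snd_sum]

/-- The Berezin integral along `V₁`, as a linear map. -/
def berezinLinear : TotalAlgebra B₀ B₁ →ₗ[ℂ] CoeffAlgebra B₀ B₁ :=
  (ExteriorAlgebra.map (LinearMap.fst ℂ _ _)).toLinearMap ∘ₗ (List.ofFn (dxi b)).prod

theorem berezin_expMoment (u : V₀) (X : spoEven B₀ B₁) (l : Module.Dual ℂ (CoeffAlgebra B₀ B₁)) :
    l (berezin b (expMoment b u X)) = Complex.exp (-(Complex.I / 2) * (B₀ u (X.1.1 u) : ℂ)) *
      l (berezinLinear b (IsNilpotent.exp ((-(Complex.I / 2)) • momentSoul b u X))) := by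
  have h : ∀ φ, berezin b φ = berezinLinear b φ := fun _ => rfl
  rw [h, expMoment, map_smul, map_smul, smul_eq_mul]

variable [FiniteDimensional ℝ V₀] [FiniteDimensional ℝ V₁]

theorem contDiff_linearMap {E F : Type*} [NormedAddCommGroup E] [NormedSpace ℝ E]
    [FiniteDimensional ℝ E] [NormedAddCommGroup F] [NormedSpace ℝ F] (f : E →ₗ[ℝ] F) :
    ContDiff ℝ ∞ f := f.toContinuousLinearMap.contDiff

theorem linear_mem_amplitudes {ι E W : Type*} [Fintype ι] [NormedAddCommGroup E] [NormedSpace ℝ E]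
    [AddCommGroup W] [Module ℂ W] (v : ι → W) :
    (fun (x : ι → ℝ) (_ : E) => ∑ i, (x i : ℂ) • v i) ∈ amplitudes ι E W := by
  have h : (fun (x : ι → ℝ) (_ : E) => ∑ i, (x i : ℂ) • v i)
      = ∑ i, fun (x : ι → ℝ) (_ : E) => (x i : ℂ) • v i := by
    ext x X
    simp
  rw [h]
  refine Submodule.sum_mem _ fun i _ => ?_
  simpa [monomialFun] using
    mem_amplitudes (ι := ι) [i] (contDiff_const (𝕜 := ℝ) (E := E) (c := (1 : ℂ))) (v i)

/-- The terms in `D` are linear in `X` and free of `x`; the mixed terms are linear in `x` and free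
of `X`. -/
theorem momentSoul_mem_amplitudes :
    (fun x X => momentSoul b (b.even.equivFun.symm x) X)
      ∈ amplitudes (Fin r ⊕ Fin r) (spoEven B₀ B₁) (TotalAlgebra B₀ B₁) := by
  have h1 : ∀ i j, (fun (_ : Fin r ⊕ Fin r → ℝ) (X : spoEven B₀ B₁) =>
      (b.coeff i * b.coeff j * (B₁ (b.odd i) (X.2.1 (b.odd j)) : ℂ)) • (xi b j * xi b i))
      ∈ amplitudes (Fin r ⊕ Fin r) (spoEven B₀ B₁) (TotalAlgebra B₀ B₁) := fun i j => by
    let L : spoEven B₀ B₁ →ₗ[ℝ] ℝ :=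
      { toFun := fun X => B₁ (b.odd i) (X.2.1 (b.odd j))
        map_add' := fun X Y => by simp
        map_smul' := fun t X => by simp }
    have hL' : ContDiff ℝ ∞ fun X => L X := contDiff_linearMap (E := spoEven B₀ B₁) L
    have hL : ContDiff ℝ ∞ fun X : spoEven B₀ B₁ => b.coeff i * b.coeff j * (L X : ℂ) :=
      contDiff_const.mul (Complex.ofRealCLM.contDiff.comp hL')
    simpa [monomialFun, L] using mem_amplitudes (ι := Fin r ⊕ Fin r) [] hL (xi b j * xi b i)
  have h2 : ∀ j, (fun (x : Fin r ⊕ Fin r → ℝ) (_ : spoEven B₀ B₁) =>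
      xi b j * formEvenOdd b (b.even.equivFun.symm x) j)
      ∈ amplitudes (Fin r ⊕ Fin r) (spoEven B₀ B₁) (TotalAlgebra B₀ B₁) := fun j => by
    simp only [formEvenOdd_equivFun]
    exact mul_mem_amplitudes (const_mem_amplitudes _) (linear_mem_amplitudes _)
  have h3 : ∀ j, (fun (x : Fin r ⊕ Fin r → ℝ) (_ : spoEven B₀ B₁) =>
      formOddEven b (b.even.equivFun.symm x) j * xi b j)
      ∈ amplitudes (Fin r ⊕ Fin r) (spoEven B₀ B₁) (TotalAlgebra B₀ B₁) := fun j => by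
    simp only [formOddEven_equivFun]
    exact mul_mem_amplitudes (linear_mem_amplitudes _) (const_mem_amplitudes _)
  convert Submodule.add_mem _ (Submodule.add_mem _
    (Submodule.sum_mem _ fun i (_ : i ∈ Finset.univ) =>
      Submodule.sum_mem _ fun j (_ : j ∈ Finset.univ) => h1 i j)
    (Submodule.sum_mem _ fun j (_ : j ∈ Finset.univ) => h2 j))
    (Submodule.sum_mem _ fun j (_ : j ∈ Finset.univ) => h3 j) using 1
  ext x X
  simp [momentSoul]

/-- Uniform nilpotency makes the exponential one fixed polynomial in the soul, for all `x` and `X`.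
-/
theorem exp_momentSoul_mem_amplitudes (c : ℂ) :
    (fun x X => IsNilpotent.exp (c • momentSoul b (b.even.equivFun.symm x) X))
      ∈ amplitudes (Fin r ⊕ Fin r) (spoEven B₀ B₁) (TotalAlgebra B₀ B₁) := by
  have h : (fun x X => IsNilpotent.exp (c • momentSoul b (b.even.equivFun.symm x) X))
      = ∑ k ∈ Finset.range (expOrder n), ((k.factorial : ℂ)⁻¹ * c ^ k) •
        (fun x X => momentSoul b (b.even.equivFun.symm x) X) ^ k := by
    ext x X
    rw [exp_smul_eq_sum_range (momentSoul_pow_eq_zero b _ X), Finset.sum_apply, Finset.sum_apply]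
    rfl
  rw [h]
  exact Submodule.sum_mem _ fun k _ =>
    Submodule.smul_mem _ _ (pow_mem_amplitudes (momentSoul_mem_amplitudes b) k)

end Amplitude

end SuperPfaffian
end

/-! ### The scalar component and its Pfaffian. -/

noncomputable section

namespace SuperPfaffian

/-- Nondegeneracy represents any bilinear form as `B(·, D ·)`. The sign `s` treats both cases
together: `s = -1` gives `sp` and symmetric `M`, `s = 1` gives `so` and antisymmetric `M`. -/
theorem exists_skewEnd {E κ : Type*} [NormedAddCommGroup E] [NormedSpace ℝ E]
    [FiniteDimensional ℝ E] [Fintype κ] [DecidableEq κ] {B : LinearMap.BilinForm ℝ E}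
    (hB : B.Nondegenerate) {s : ℝ} (hs : s * s = 1) (hsymm : ∀ v w, B v w = s * B w v)
    (e : Module.Basis κ ℝ E) {M : Matrix κ κ ℝ} (hM : ∀ i j, M j i = -s * M i j) :
    ∃ D : skewEnd B, ∀ i j, B (e i) (D.1 (e j)) = M i j := by
  set C : LinearMap.BilinForm ℝ E := Matrix.toBilin e M with hC
  have hCe : ∀ i j, C (e i) (e j) = M i j := fun i j => by
    rw [hC, ← LinearMap.BilinForm.toMatrix_apply e, LinearMap.BilinForm.toMatrix_toBilin]
  have hCs : ∀ v w, C w v = -s * C v w := by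
    have h : C.flip = (-s) • C := by
      refine LinearMap.BilinForm.ext_basis e fun i j => ?_
      change C (e j) (e i) = -s * C (e i) (e j)
      rw [hCe, hCe, hM]
    intro v w
    exact LinearMap.congr_fun (LinearMap.congr_fun h v) w
  let D : E →ₗ[ℝ] E := (B.toDual hB).symm.toLinearMap ∘ₗ (s • C.flip)
  have hD : ∀ v w, B (D v) w = s * C w v := fun v w => by
    change B ((B.toDual hB).symm ((s • C.flip) v)) w = _
    rw [LinearMap.BilinForm.apply_toDual_symm_apply]
    rfl
  have hD' : ∀ v w, B w (D v) = C w v := fun v w => by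
    rw [hsymm, hD, ← mul_assoc, hs, one_mul]
  refine ⟨⟨D.toContinuousLinearMap, fun v w => ?_⟩, fun i j => ?_⟩
  · change B (D v) w + B v (D w) = 0
    rw [hD, hD', hCs v w]
    linear_combination (-C v w) * hs
  · exact (hD' _ _).trans (hCe i j)

section ScalarComponent

variable {V₀ V₁ : Type*} [NormedAddCommGroup V₀] [NormedSpace ℝ V₀]
  [NormedAddCommGroup V₁] [NormedSpace ℝ V₁]
  {B₀ : LinearMap.BilinForm ℝ V₀} {B₁ : LinearMap.BilinForm ℝ V₁}
  {r n : ℕ} (b : OrientedSymplecticBasis B₀ B₁ r n)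

/-- The scalar component of the coefficient algebra. -/
def scalarPart : Module.Dual ℂ (CoeffAlgebra B₀ B₁) :=
  (ExteriorAlgebra.algebraMapInv (R := ℂ)).toLinearMap

/-- The scalar component of the Berezin integral. -/
def oddTop : TotalAlgebra B₀ B₁ →ₗ[ℂ] ℂ :=
  (ExteriorAlgebra.algebraMapInv (R := ℂ)).toLinearMap ∘ₗ (List.ofFn (dxi b)).prod

theorem algebraMapInv_map {M N : Type*} [AddCommGroup M] [Module ℂ M] [AddCommGroup N] [Module ℂ N]
    (f : M →ₗ[ℂ] N) (x : ExteriorAlgebra ℂ M) :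
    ExteriorAlgebra.algebraMapInv (R := ℂ) (ExteriorAlgebra.map f x)
      = ExteriorAlgebra.algebraMapInv (R := ℂ) x := by
  have h : (ExteriorAlgebra.algebraMapInv (R := ℂ)).comp (ExteriorAlgebra.map f)
      = ExteriorAlgebra.algebraMapInv (R := ℂ) (M := M) := by
    refine ExteriorAlgebra.hom_ext (LinearMap.ext fun m => ?_)
    simp [ExteriorAlgebra.algebraMapInv]
  exact DFunLike.congr_fun h x

theorem scalarPart_berezinLinear (φ : TotalAlgebra B₀ B₁) :
    scalarPart (berezinLinear b φ) = oddTop b φ :=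
  algebraMapInv_map _ _

variable (B₀ B₁) in
/-- The projection that sets the odd coordinates of `spo(V)` to zero. -/
def killCoeff : TotalAlgebra B₀ B₁ →ₐ[ℂ] TotalAlgebra B₀ B₁ :=
  ExteriorAlgebra.map (LinearMap.prod 0 (LinearMap.snd ℂ _ _))

theorem prod_dxi_killCoeff (L : List (Fin n)) (φ : TotalAlgebra B₀ B₁) :
    (L.map (dxi b)).prod (killCoeff B₀ B₁ φ) = killCoeff B₀ B₁ ((L.map (dxi b)).prod φ) := by
  induction L with
  | nil => rfl
  | cons j L ih =>
    rw [List.map_cons, List.prod_cons, Module.End.mul_apply, Module.End.mul_apply, ih]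
    exact contractLeft_map (fun m => rfl) _

theorem oddTop_killCoeff (φ : TotalAlgebra B₀ B₁) :
    oddTop b (killCoeff B₀ B₁ φ) = oddTop b φ := by
  change ExteriorAlgebra.algebraMapInv (R := ℂ) ((List.ofFn (dxi b)).prod (killCoeff B₀ B₁ φ))
    = ExteriorAlgebra.algebraMapInv (R := ℂ) ((List.ofFn (dxi b)).prod φ)
  rw [List.ofFn_eq_map, prod_dxi_killCoeff]
  exact algebraMapInv_map _ _

theorem killCoeff_momentSoul (u : V₀) (X : spoEven B₀ B₁) :
    killCoeff B₀ B₁ (momentSoul b u X) = oddMoment b X.2 := by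
  have h1 : ∀ j, killCoeff B₀ B₁ (xi b j) = xi b j := fun j => by
    rw [killCoeff, xi, ExteriorAlgebra.map_apply_ι]
    rfl
  have h2 : ∀ j, killCoeff B₀ B₁ (formEvenOdd b u j) = 0 := fun j => by
    rw [killCoeff, formEvenOdd, ExteriorAlgebra.map_apply_ι]
    exact map_zero _
  have h3 : ∀ j, killCoeff B₀ B₁ (formOddEven b u j) = 0 := fun j => by
    rw [killCoeff, formOddEven, ExteriorAlgebra.map_apply_ι]
    exact map_zero _
  simp only [momentSoul, map_add, map_sum, map_smul, map_mul, h1, h2, h3, mul_zero, zero_mul,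
    Finset.sum_const_zero, add_zero]
  rfl

theorem oddMoment_pow_eq_zero (D : skewEnd B₁) : oddMoment b D ^ expOrder n = 0 := by
  have h := killCoeff_momentSoul b 0 ((0, D) : spoEven B₀ B₁)
  rw [← show oddMoment b ((0, D) : spoEven B₀ B₁).2 = oddMoment b D from rfl, ← h, ← map_pow,
    expOrder, momentSoul_pow_eq_zero, map_zero]

/-- The scalar component of the Berezin integral of the exponential of the moment, which is a
multiple of the Pfaffian of `D`. -/
def oddPfaffian (c : ℂ) (D : skewEnd B₁) : ℂ := oddTop b (IsNilpotent.exp (c • oddMoment b D))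

/-- Setting the odd coordinates of `spo(V)` to zero commutes with the Berezin derivatives, preserves
scalar parts and removes the mixed terms, the only ones that involve `u`. -/
theorem scalarPart_berezinLinear_exp (c : ℂ) (u : V₀) (X : spoEven B₀ B₁) :
    scalarPart (berezinLinear b (IsNilpotent.exp (c • momentSoul b u X)))
      = oddPfaffian b c X.2 := by
  rw [scalarPart_berezinLinear, oddPfaffian, ← oddTop_killCoeff,
    exp_smul_eq_sum_range (momentSoul_pow_eq_zero b u X),
    exp_smul_eq_sum_range (oddMoment_pow_eq_zero b X.2)]
  simp only [map_sum, map_smul, map_pow, killCoeff_momentSoul]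
  rfl

theorem commute_oddMoment (D D' : skewEnd B₁) : Commute (oddMoment b D) (oddMoment b D') := by
  change Commute (∑ i, ∑ j, (b.coeff i * b.coeff j * (B₁ (b.odd i) (D.1 (b.odd j)) : ℂ)) •
    (xi b j * xi b i)) (∑ i, ∑ j, (b.coeff i * b.coeff j *
      (B₁ (b.odd i) (D'.1 (b.odd j)) : ℂ)) • (xi b j * xi b i))
  refine Commute.sum_left _ _ _ fun i _ => Commute.sum_left _ _ _ fun j _ =>
    Commute.sum_right _ _ _ fun k _ => Commute.sum_right _ _ _ fun l _ => ?_
  exact ((commute_ι_mul_ι _ _ _ _).smul_left _).smul_right _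

/-- Polynomiality on lines is all that is needed to spread nonvanishing from one point to every open
set. -/
theorem exists_polynomial_oddPfaffian (c : ℂ) (D D' : skewEnd B₁) :
    ∃ P : Polynomial ℂ, ∀ t : ℝ, oddPfaffian b c (D + t • D') = P.eval (t : ℂ) := by
  refine ⟨∑ k ∈ Finset.range (expOrder n), ∑ m ∈ Finset.range (k + 1),
    Polynomial.C ((k.factorial : ℂ)⁻¹ * c ^ k * (k.choose m : ℂ) *
      oddTop b (oddMoment b D ^ m * oddMoment b D' ^ (k - m))) * Polynomial.X ^ (k - m), fun t => ?_⟩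
  rw [oddPfaffian, exp_smul_eq_sum_range (oddMoment_pow_eq_zero b _), map_sum,
    Polynomial.eval_finsetSum]
  refine Finset.sum_congr rfl fun k _ => ?_
  have e : oddMoment b (D + t • D') = oddMoment b D + (t : ℂ) • oddMoment b D' := by
    rw [map_add, map_smul]
    exact congrArg _ (algebraMap_smul ℂ t _).symm
  rw [map_smul, e, add_smul_pow (commute_oddMoment b D D'), map_sum, Finset.smul_sum,
    Polynomial.eval_finsetSum]
  refine Finset.sum_congr rfl fun m _ => ?_
  rw [map_smul]
  simp only [Polynomial.eval_mul, Polynomial.eval_C, Polynomial.eval_pow, Polynomial.eval_X,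
    smul_eq_mul]
  ring

/-- The vector `f_j` as a linear form on the odd coordinates. -/
def dualVec (j : Fin n) : Module.Dual ℂ ((spoOdd B₀ B₁ →ₗ[ℝ] ℂ) × (V₁ →ₗ[ℝ] ℂ)) where
  toFun φ := b.coeff j * φ.2 (b.odd j)
  map_add' φ ψ := by simp [mul_add]
  map_smul' c φ := by simp [mul_left_comm]

/-- The linear form `ξ^j`. -/
def coordVec (j : Fin n) : (spoOdd B₀ B₁ →ₗ[ℝ] ℂ) × (V₁ →ₗ[ℝ] ℂ) :=
  (0, (b.coeff j)⁻¹ • (Complex.ofRealCLM.toLinearMap ∘ₗ b.odd.coord j))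

theorem coeff_ne_zero (j : Fin n) : b.coeff j ≠ 0 := by
  rcases b.coeff_eq j with h | h <;> simp [h]

theorem dualVec_coordVec (i j : Fin n) : dualVec b i (coordVec b j) = if i = j then 1 else 0 := by
  have := coeff_ne_zero b j
  by_cases h : i = j
  · subst h
    simp [dualVec, coordVec, this]
  · simp [dualVec, coordVec, h]

variable [FiniteDimensional ℝ V₁]

/-- `D` realizes the matrix `E_ij - E_ji`. Its two entries give equal terms once the odd coordinates
are swapped, hence the factor `-2`. -/
theorem exists_oddMoment_eq (hB : IsSymplectic B₀ B₁) (i j : Fin n) :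
    ∃ D : skewEnd B₁, oddMoment b D = (-2 * (b.coeff i * b.coeff j)) • (xi b i * xi b j) := by
  obtain ⟨D, hD⟩ := exists_skewEnd hB.odd_nondegenerate (s := 1) (by norm_num)
    (fun v w => by rw [one_mul]; exact hB.odd_symm.eq v w) b.odd
    (M := Matrix.single i j 1 - Matrix.single j i 1) (fun k l => by
      simp only [Matrix.sub_apply, Matrix.single_apply, and_comm]; ring)
  refine ⟨D, ?_⟩
  change ∑ k, ∑ l, (b.coeff k * b.coeff l * (B₁ (b.odd k) (D.1 (b.odd l)) : ℂ)) •
    (xi b l * xi b k) = _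
  have hterm : ∀ k l, (b.coeff k * b.coeff l * (B₁ (b.odd k) (D.1 (b.odd l)) : ℂ)) •
      (xi b l * xi b k)
      = (if i = k then if j = l then (b.coeff k * b.coeff l) • (xi b l * xi b k) else 0 else 0)
        - if j = k then if i = l then (b.coeff k * b.coeff l) • (xi b l * xi b k) else 0 else 0 := by
    intro k l
    rw [hD, Matrix.sub_apply, Matrix.single_apply, Matrix.single_apply]
    rw [ite_and, ite_and]
    split_ifs <;> simp
  simp only [hterm, Finset.sum_sub_distrib, Finset.sum_ite_eq, Finset.mem_univ, if_true,
    Finset.sum_ite_irrel, Finset.sum_const_zero]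
  have hs : xi b j * xi b i = -(xi b i * xi b j) := ι_mul_ι_swap _ _
  rw [hs, mul_comm (b.coeff j), smul_neg, ← neg_smul, ← sub_smul]
  congr 1
  ring

-- Since `n = 2h`, the odd coordinates pair up. A sum of elementary `D k` has moment `∑ a_k ξ^{2k}
-- ξ^{2k+1}`, and the Berezin integral of its exponential is `∏ (-c a_k)`.
set_option maxHeartbeats 800000 in
theorem exists_oddPfaffian_ne_zero (hB : IsSymplectic B₀ B₁) (hn : Even n) {c : ℂ} (hc : c ≠ 0) :
    ∃ D, oddPfaffian b c D ≠ 0 := by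
  obtain ⟨h, hh⟩ := hn
  let v : ℕ → (spoOdd B₀ B₁ →ₗ[ℝ] ℂ) × (V₁ →ₗ[ℝ] ℂ) := fun i =>
    if hi : i < n then coordVec b ⟨i, hi⟩ else 0
  let d : ℕ → Module.Dual ℂ ((spoOdd B₀ B₁ →ₗ[ℝ] ℂ) × (V₁ →ₗ[ℝ] ℂ)) := fun i =>
    if hi : i < n then dualVec b ⟨i, hi⟩ else 0
  have hdv : ∀ i < 2 * h, ∀ j < 2 * h, d i (v j) = if i = j then 1 else 0 := by
    intro i hi j hj
    simp only [d, v, dif_pos (show i < n by omega), dif_pos (show j < n by omega),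
      dualVec_coordVec, Fin.mk.injEq]
  have hlist : List.ofFn (dxi b) = (List.range (2 * h)).map fun i =>
      (CliffordAlgebra.contractLeft (d i) : Module.End ℂ (TotalAlgebra B₀ B₁)) := by
    refine List.ext_getElem (by simp; omega) fun i h1 h2 => ?_
    have hi : i < n := by simpa using h1
    rw [List.getElem_ofFn, List.getElem_map, List.getElem_range]
    simp only [d, dif_pos hi]
    rfl
  have hD : ∀ k : ℕ, ∃ D : skewEnd B₁, ∃ a : ℂ, a ≠ 0 ∧ oddMoment b D
      = a • (ExteriorAlgebra.ι ℂ (v (2 * k)) * ExteriorAlgebra.ι ℂ (v (2 * k + 1))) := by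
    intro k
    by_cases hk : k < h
    · have h1 : 2 * k < n := by omega
      have h2 : 2 * k + 1 < n := by omega
      obtain ⟨D, hD⟩ := exists_oddMoment_eq b hB ⟨2 * k, h1⟩ ⟨2 * k + 1, h2⟩
      refine ⟨D, -2 * (b.coeff ⟨2 * k, h1⟩ * b.coeff ⟨2 * k + 1, h2⟩), ?_, ?_⟩
      · exact mul_ne_zero (by norm_num) (mul_ne_zero (coeff_ne_zero b _) (coeff_ne_zero b _))
      · rw [hD]
        simp only [v, dif_pos h1, dif_pos h2]
        rfl
    -- Default beyond the range: `v` is extended by zero past `n`, so both sides vanish.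
    · refine ⟨0, 1, one_ne_zero, ?_⟩
      have hv : v (2 * k) = 0 := dif_neg (by omega)
      rw [hv]
      exact ((oddMoment b).map_zero).trans (smul_ι_zero_mul 1 _).symm
  choose D a ha hDa using hD
  refine ⟨∑ k ∈ Finset.range h, D k, ?_⟩
  have hsum : c • oddMoment b (∑ k ∈ Finset.range h, D k) = ∑ k ∈ Finset.range h, (c * a k) •
      (ExteriorAlgebra.ι ℂ (v (2 * k)) * ExteriorAlgebra.ι ℂ (v (2 * k + 1))) := by
    refine (congrArg (c • ·) (map_sum (oddMoment b) D _)).trans ?_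
    refine Finset.smul_sum.trans (Finset.sum_congr rfl fun k _ => ?_)
    exact (congrArg (c • ·) (hDa k)).trans (smul_smul _ _ _)
  rw [oddPfaffian, hsum, exp_sum_smul_ι_mul_ι v (fun k => c * a k) h]
  change ExteriorAlgebra.algebraMapInv (R := ℂ) ((List.ofFn (dxi b)).prod _) ≠ 0
  rw [hlist, prod_contractLeft_prod (fun k => c * a k) h hdv, map_smul, map_one, smul_eq_mul, mul_one]
  refine List.prod_ne_zero fun h0 => ?_
  obtain ⟨k, -, hk⟩ := List.mem_map.1 h0
  exact mul_ne_zero hc (ha k) (neg_eq_zero.1 hk)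

/-- Otherwise, on the line from `D₀` to a point where the Pfaffian is nonzero, a polynomial would
have infinitely many roots near `t = 0`. -/
theorem exists_oddPfaffian_ne_zero_mem_nhds (hB : IsSymplectic B₀ B₁) (hn : Even n) {c : ℂ}
    (hc : c ≠ 0) {D₀ : skewEnd B₁} {W : Set (skewEnd B₁)} (hW : W ∈ nhds D₀) :
    ∃ D ∈ W, oddPfaffian b c D ≠ 0 := by
  by_contra! hzero
  obtain ⟨D₁, hD₁⟩ := exists_oddPfaffian_ne_zero b hB hn hc
  obtain ⟨P, hP⟩ := exists_polynomial_oddPfaffian b c D₀ (D₁ - D₀)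
  have hcont : Continuous fun t : ℝ => D₀ + t • (D₁ - D₀) := by fun_prop
  have h1 : ∀ᶠ t : ℝ in nhds 0, D₀ + t • (D₁ - D₀) ∈ W :=
    hcont.continuousAt.preimage_mem_nhds (by simpa using hW)
  have h2 : {t : ℝ | D₀ + t • (D₁ - D₀) ∈ W}.Infinite := infinite_of_mem_nhds 0 h1
  have h3 : P = 0 := by
    refine Polynomial.eq_zero_of_infinite_isRoot P
      ((h2.image Complex.ofReal_injective.injOn).mono ?_)
    rintro _ ⟨t, ht, rfl⟩
    exact (hP t).symm.trans (hzero _ ht)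
  refine hD₁ ?_
  have := hP 1
  rwa [h3, Polynomial.eval_zero, one_smul, add_sub_cancel] at this

end ScalarComponent

end SuperPfaffian
end

/-! ### Assembly of the superPfaffian. -/

noncomputable section

namespace SuperPfaffian

theorem contDiff_of_mem_amplitudes {ι E : Type*} [NormedAddCommGroup E] [NormedSpace ℝ E]
    {f : (ι → ℝ) → E → ℂ} (hf : f ∈ amplitudes ι E ℂ) (x : ι → ℝ) : ContDiff ℝ ∞ (f x) := by
  induction hf using Submodule.span_induction with
  | mem f hf =>
    obtain ⟨w, d, v, hd, rfl⟩ := hf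
    exact (contDiff_const.mul hd).smul contDiff_const
  | zero => exact contDiff_const
  | add f g _ _ hf hg => exact hf.add hg
  | smul c f _ hf => exact hf.const_smul c

/-- Real test functions as complex test functions. -/
def ofRealTest (E : Type*) [NormedAddCommGroup E] [NormedSpace ℝ E] :
    𝓓((⊤ : Opens E), ℝ) →L[ℝ] 𝓓((⊤ : Opens E), ℂ) :=
  TestFunction.postcompCLM Complex.ofRealCLM

theorem tsupport_ofRealTest {E : Type*} [NormedAddCommGroup E] [NormedSpace ℝ E]
    (ρ : 𝓓((⊤ : Opens E), ℝ)) : tsupport (ofRealTest E ρ) ⊆ tsupport ρ :=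
  tsupport_comp_subset (map_zero Complex.ofRealCLM) ρ

/-- The generalized function defined by an oscillating integral is smooth where `Q` is non
degenerate. If the amplitude is a function `p` of `X` only, it is not smooth near a point where `Q`
is degenerate, unless `p` vanishes at all the degenerate points nearby. -/
theorem exists_oscillatory_distribution {ι : Type*} [Fintype ι] [DecidableEq ι] {E : Type*}
    [NormedAddCommGroup E] [NormedSpace ℝ E] [FiniteDimensional ℝ E] [MeasurableSpace E]
    [BorelSpace E] (μ : Measure E) [μ.IsAddHaarMeasure] {Q : E →ₗ[ℝ] Matrix ι ι ℝ}
    (hQ : ∀ X, (Q X).IsSymm) (hspan : ∀ S : Matrix ι ι ℝ, S.IsSymm → ∃ Z, Q Z = S)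
    {f : (ι → ℝ) → E → ℂ} (hf : f ∈ amplitudes ι E ℂ) {c : ℂ} (hc : c ≠ 0) :
    ∃ S : 𝓓'((⊤ : Opens E), ℂ),
      (∀ ρ : 𝓓((⊤ : Opens E), ℝ),
        Integrable (fun x => ∫ X, (ρ X : ℂ) * (phase (Q X) x * f x X) ∂μ) ∧
        S ρ = c * ∫ x, ∫ X, (ρ X : ℂ) * (phase (Q X) x * f x X) ∂μ) ∧
      (∀ X, (Q X).det ≠ 0 → X ∉ singularSupport μ S) ∧
      ∀ p : E → ℂ, (∀ x X, f x X = p X) → ∀ X, X ∉ singularSupport μ S →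
        ∃ U ∈ nhds X, ∀ Y ∈ U, (Q Y).det = 0 → p Y = 0 := by
  obtain ⟨-, T, hT, hTF⟩ := exists_distribution_of_mem_amplitudes μ hQ hspan hf
  -- `T` acts on complex test functions, whereas generalized functions are tested on real ones;
  -- hence the restriction of scalars.
  let L : 𝓓((⊤ : Opens E), ℝ) →L[ℝ] ℂ := c • (T.restrictScalars ℝ).comp (ofRealTest E)
  let S : 𝓓'((⊤ : Opens E), ℂ) :=
    { toFun := L
      map_add' := L.map_add
      map_smul' := L.map_smul
      cont := L.cont }
  have hS : ∀ ρ, S ρ = c * T (ofRealTest E ρ) := fun _ => rfl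
  have hST : ∀ ρ : 𝓓((⊤ : Opens E), ℝ),
      S ρ = c * ∫ x, ∫ X, (ρ X : ℂ) * (phase (Q X) x * f x X) ∂μ := fun ρ => by
    rw [hS, (hT _).2]
    rfl
  refine ⟨S, fun ρ => ⟨(hT (ofRealTest E ρ)).1, hST ρ⟩, fun X hX hsing => hsing ?_,
    fun p hp X hX => ?_⟩
  · obtain ⟨U, hU, hXU, F, hF, hφ⟩ := hTF X hX
    refine ⟨U, hU, hXU, fun Y => c * F Y, contDiffOn_const.mul hF, fun ρ hρ => ?_⟩
    rw [hS, hφ _ ((tsupport_ofRealTest ρ).trans hρ), ← integral_const_mul]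
    congr 1
    ext Y
    exact mul_left_comm _ _ _
  · obtain ⟨U, hU, hXU, F, hF, hρ⟩ := not_not.1 hX
    have hps : ContDiff ℝ ∞ p := by
      have h := contDiff_of_mem_amplitudes hf 0
      rwa [show f 0 = p from funext (hp 0)] at h
    refine ⟨U, hU.mem_nhds hXU, fun Y hY hdet => ?_⟩
    refine amplitude_eq_zero_of_continuousOn μ hQ hspan hps hc hU hF.continuousOn
      (fun ρ hρU => ?_) hY hdet
    rw [← hρ ρ hρU, hST]
    simp only [hp]

section Assembly

variable {V₀ V₁ : Type*} [NormedAddCommGroup V₀] [NormedSpace ℝ V₀]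
  [NormedAddCommGroup V₁] [NormedSpace ℝ V₁]
  {B₀ : LinearMap.BilinForm ℝ V₀} {B₁ : LinearMap.BilinForm ℝ V₁}
  {r n : ℕ} (b : OrientedSymplecticBasis B₀ B₁ r n)

/-- The matrix of the quadratic form `v ↦ B₀(v, A v)`, as a function of `X = (A, D)`. -/
def evenMatrix : spoEven B₀ B₁ →ₗ[ℝ] Matrix (Fin r ⊕ Fin r) (Fin r ⊕ Fin r) ℝ where
  toFun X := Matrix.of fun i j => B₀ (b.even i) (X.1.1 (b.even j))
  map_add' X Y := by ext i j; simp
  map_smul' c X := by ext i j; simp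

theorem isSymm_evenMatrix (hB : IsSymplectic B₀ B₁) (X : spoEven B₀ B₁) :
    (evenMatrix b X).IsSymm := by
  ext i j
  have h1 := X.1.2 (b.even i) (b.even j)
  have h2 := hB.even_alt.neg_eq (X.1.1 (b.even i)) (b.even j)
  change B₀ (b.even j) (X.1.1 (b.even i)) = B₀ (b.even i) (X.1.1 (b.even j))
  linarith

theorem even_apply_eq (x : Fin r ⊕ Fin r → ℝ) (X : spoEven B₀ B₁) :
    B₀ (b.even.equivFun.symm x) (X.1.1 (b.even.equivFun.symm x))
      = dotProduct x ((evenMatrix b X).mulVec x) := by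
  simp only [Module.Basis.equivFun_symm_apply, map_sum, map_smul, LinearMap.sum_apply,
    LinearMap.smul_apply, smul_eq_mul, dotProduct, Matrix.mulVec, Finset.mul_sum]
  rw [Finset.sum_comm]
  refine Finset.sum_congr rfl fun i _ => Finset.sum_congr rfl fun j _ => ?_
  change _ = x i * (B₀ (b.even i) (X.1.1 (b.even j)) * x j)
  ring

/-- The amplitude of the oscillating integral that defines the superPfaffian. -/
def spfAmplitude (l : Module.Dual ℂ (CoeffAlgebra B₀ B₁)) (x : Fin r ⊕ Fin r → ℝ)
    (X : spoEven B₀ B₁) : ℂ :=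
  l (berezinLinear b
    (IsNilpotent.exp ((-(Complex.I / 2)) • momentSoul b (b.even.equivFun.symm x) X)))

theorem innerIntegral_eq (ν : Measure (spoEven B₀ B₁)) (l : Module.Dual ℂ (CoeffAlgebra B₀ B₁))
    (ρ : spoEven B₀ B₁ → ℝ) (x : Fin r ⊕ Fin r → ℝ) :
    innerIntegral b ν l ρ x
      = ∫ X, (ρ X : ℂ) * (phase (evenMatrix b X) x * spfAmplitude b l x X) ∂ν := by
  unfold innerIntegral
  congr 1
  ext X
  rw [berezin_expMoment, even_apply_eq]
  rfl

/-- The normalization constant of the superPfaffian. -/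
def spfConst (r n : ℕ) : ℂ :=
  Complex.I ^ ((2 * (r : ℂ) - n) / 2) * (((2 * Real.pi : ℝ) : ℂ) ^ r)⁻¹

theorem spfConst_ne_zero (r n : ℕ) : spfConst r n ≠ 0 := by
  refine mul_ne_zero ?_ (inv_ne_zero (pow_ne_zero _ (Complex.ofReal_ne_zero.2 Real.two_pi_pos.ne')))
  rw [Complex.cpow_def_of_ne_zero Complex.I_ne_zero]
  exact Complex.exp_ne_zero _

theorem mem_regularSet_iff (X : spoEven B₀ B₁) :
    X ∈ regularSet B₀ B₁ ↔ (evenMatrix b X).det ≠ 0 := by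
  have h := LinearMap.BilinForm.nondegenerate_iff_det_ne_zero (b := b.even)
    (B := B₀.compRight (X.1 : V₀ →L[ℝ] V₀).toLinearMap)
  refine h.trans ?_
  have e : LinearMap.BilinForm.toMatrix b.even (B₀.compRight (X.1 : V₀ →L[ℝ] V₀).toLinearMap)
      = evenMatrix b X := by
    ext i j
    rw [LinearMap.BilinForm.toMatrix_apply]
    rfl
  rw [e]

variable [FiniteDimensional ℝ V₀]

theorem exists_evenMatrix_eq (hB : IsSymplectic B₀ B₁)
    (S : Matrix (Fin r ⊕ Fin r) (Fin r ⊕ Fin r) ℝ) (hS : S.IsSymm) :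
    ∃ Z, evenMatrix b Z = S := by
  obtain ⟨A, hA⟩ := exists_skewEnd hB.even_nondegenerate (s := -1) (by norm_num)
    (fun v w => by rw [neg_one_mul, hB.even_alt.neg_eq]) b.even (M := S)
    (fun i j => by rw [neg_neg, one_mul]; exact hS.apply i j)
  exact ⟨(A, 0), Matrix.ext hA⟩

theorem isUnit_iff_det_evenMatrix (hB : IsSymplectic B₀ B₁) (X : spoEven B₀ B₁) :
    IsUnit (X.1 : V₀ →L[ℝ] V₀) ↔ (evenMatrix b X).det ≠ 0 := by
  have : CompleteSpace V₀ := FiniteDimensional.complete ℝ V₀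
  have e : evenMatrix b X = LinearMap.BilinForm.toMatrix b.even B₀ *
      LinearMap.toMatrix b.even b.even (X.1 : V₀ →L[ℝ] V₀).toLinearMap := by
    rw [← LinearMap.BilinForm.toMatrix_compRight]
    ext i j
    rw [LinearMap.BilinForm.toMatrix_apply]
    rfl
  have h0 : (LinearMap.BilinForm.toMatrix b.even B₀).det ≠ 0 :=
    (LinearMap.BilinForm.nondegenerate_iff_det_ne_zero b.even).1 hB.even_nondegenerate
  rw [e, Matrix.det_mul, LinearMap.det_toMatrix, mul_ne_zero_iff, and_iff_right h0,
    ContinuousLinearMap.isUnit_iff_bijective, ← isUnit_iff_ne_zero,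
    ← LinearMap.isUnit_iff_isUnit_det, Module.End.isUnit_iff]
  rfl

variable [FiniteDimensional ℝ V₁]

theorem spfAmplitude_mem (l : Module.Dual ℂ (CoeffAlgebra B₀ B₁)) :
    spfAmplitude b l ∈ amplitudes (Fin r ⊕ Fin r) (spoEven B₀ B₁) ℂ :=
  map_mem_amplitudes (l ∘ₗ berezinLinear b) (exp_momentSoul_mem_amplitudes b (-(Complex.I / 2)))

end Assembly

end SuperPfaffian
end

theorem mainTheorem9 {V₀ V₁ : Type*}
    [NormedAddCommGroup V₀] [NormedSpace ℝ V₀] [FiniteDimensional ℝ V₀]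
    [NormedAddCommGroup V₁] [NormedSpace ℝ V₁] [FiniteDimensional ℝ V₁]
    (B₀ : LinearMap.BilinForm ℝ V₀) (B₁ : LinearMap.BilinForm ℝ V₁)
    (hB : SuperPfaffian.IsSymplectic B₀ B₁) {r n : ℕ} (hn : Even n)
    (b : SuperPfaffian.OrientedSymplecticBasis B₀ B₁ r n)
    (ν : Measure (SuperPfaffian.spoEven B₀ B₁)) [ν.IsAddHaarMeasure] :
    ∃ Spf : Module.Dual ℂ (SuperPfaffian.CoeffAlgebra B₀ B₁) →
        𝓓'((⊤ : Opens (SuperPfaffian.spoEven B₀ B₁)), ℂ),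
      SuperPfaffian.IsSuperPfaffian b ν Spf ∧
      (⋃ l, SuperPfaffian.singularSupport ν (Spf l)) = (SuperPfaffian.regularSet B₀ B₁)ᶜ ∧
      ∀ X : SuperPfaffian.spoEven B₀ B₁,
        X ∈ (⋃ l, SuperPfaffian.singularSupport ν (Spf l)) ↔
          ¬ IsUnit (X.1 : V₀ →L[ℝ] V₀) := by
  have hmem := fun l => SuperPfaffian.spfAmplitude_mem b l
  have hex := fun l => SuperPfaffian.exists_oscillatory_distribution
    (E := SuperPfaffian.spoEven B₀ B₁) ν (SuperPfaffian.isSymm_evenMatrix b hB)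
    (SuperPfaffian.exists_evenMatrix_eq b hB) (hmem l) (SuperPfaffian.spfConst_ne_zero r n)
  choose Spf hSpf hsmooth hsingular using hex
  have hsing : (⋃ l, SuperPfaffian.singularSupport ν (Spf l))
      = (SuperPfaffian.regularSet B₀ B₁)ᶜ := by
    ext X
    rw [Set.mem_iUnion, Set.mem_compl_iff, SuperPfaffian.mem_regularSet_iff b]
    constructor
    · rintro ⟨l, hl⟩ hX
      exact hsmooth l X hX hl
    · intro hX
      -- The scalar component alone is singular at every degenerate point.
      refine ⟨SuperPfaffian.scalarPart, by_contra fun hns => ?_⟩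
      obtain ⟨U, hU, hzero⟩ := hsingular SuperPfaffian.scalarPart
        (fun Y => SuperPfaffian.oddPfaffian b (-(Complex.I / 2)) Y.2)
        (fun x Y => SuperPfaffian.scalarPart_berezinLinear_exp b _ _ Y) X hns
      have hcont : Continuous fun D : SuperPfaffian.skewEnd B₁ =>
          ((X.1, D) : SuperPfaffian.spoEven B₀ B₁) := by fun_prop
      obtain ⟨D, hDU, hD⟩ := SuperPfaffian.exists_oddPfaffian_ne_zero_mem_nhds b hB hn
        (c := -(Complex.I / 2)) (by simp) (D₀ := X.2) (hcont.continuousAt.preimage_mem_nhds hU)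
      -- Only `D` has been moved, so `(X.1, D)` is still degenerate, yet the Pfaffian is nonzero
      -- there.
      exact hD (hzero (X.1, D) hDU (not_not.1 hX))
  refine ⟨Spf, fun l ρ => ?_, hsing, fun X => ?_⟩
  · have hinner : SuperPfaffian.innerIntegral b ν l ρ = _ :=
      funext fun x => SuperPfaffian.innerIntegral_eq b ν l ρ x
    rw [SuperPfaffian.pairing, hinner]
    exact hSpf l ρ
  · refine (Set.ext_iff.1 hsing X).trans ?_
    rw [Set.mem_compl_iff, SuperPfaffian.mem_regularSet_iff b,
      SuperPfaffian.isUnit_iff_det_evenMatrix b hB]
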